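/- Let $\mathbb N=\{1,2,\dots\}$ and write $x_{1:n}=(x_1,\dots,x_n)\in\{0,1\}^n$, with $x_{1:0}=\emptyset$. **Partitions.** A nested binary partition (NBP) of $[0,1)$ is a family $I$ of intervals $I_{x_{1:n}}=[a_{x_{1:n}},a_{x_{1:n}}+\ell_{x_{1:n}})$, $x_{1:n}\in\{0,1\}^n$, $n\in\mathbb N$, with $a_{x_{1:n}}\in[0,1)$ and $\ell_{x_{1:n}}\in(0,1)$, such that with $a_\emptyset=0$, $\ell_\emptyset=1$, for all $n\ge 0$ and all $x_{1:n}$: $a_{x_{1:n}}=a_{x_{1:n},0}$, $a_{x_{1:n},1}=a_{x_{1:n},0}+\ell_{x_{1:n},0}$ and $\ell_{x_{1:n}}=\ell_{x_{1:n},0}+\ell_{x_{1:n},1}$. It is called shrinking if $\ell_{x_{1:n}}\to0$ as $n\to\infty$ for every $t\in[0,1)$ with digits $(x_1,x_2,\dots)$, i.e. $t\in I_{x_{1:n}}$ for all $n$. **Priors.** For parameters $\alpha=(\alpha_{x_{1:n}})$, $Y\sim\mathrm{BS}(\alpha)$ means that $Y_{x_{1:n-1},0}\sim\mathrm{Beta}(\alpha_{x_{1:n-1},0},\alpha_{x_{1:n-1},1})$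 are independent over all $n\in\mathbb N$ and $x_{1:n-1}$, and $Y_{x_{1:n-1},1}=1-Y_{x_{1:n-1},0}$. Let $N$ have probability mass function $(p_n)_{n\ge0}$. - GFPT1: given a shrinking NBP $I$, let $Y\sim\mathrm{BS}(\alpha)$ be independent of $N$, and let $f(t)=\prod_{j=1}^N Y_{x_{1:j}}/\ell_{x_{1:N}}$ for $t\in I_{x_{1:N}}$. The prior $\Pi_1$ is the law of the random density $f$. - GFPT2: let $Y\sim\mathrm{BS}(\alpha)$, $R\sim\mathrm{BS}(\beta)$ and $N$ be independent, and let $f(t)=\prod_{j=1}^N Y_{x_{1:j}}/L_{x_{1:N}}$ for $t\in I_{x_{1:N}}$, where $I$ is now the random NBP with interval lengths $L_{x_{1:n}}=\prod_{j=1}^nR_{x_{1:j}}$. The prior $\Pi_2$ is the law of $f$. For $i=1,2$, $\Pi_i(\cdot\mid Z_{1:m})$ denotes the posterior distribution of $f$ given $Z_{1:m}$ in the model in which $f\sim\Pi_i$ and, given $f$ (and its latent variables), $Z_1,\dots,Z_m$ are i.i.d. with density $f$. For densities $f_1,f_2$ on $[0,1)$ let $d_{\mathrm{KS}}(f_1,f_2)=\sup_{x\in[0,1)}\left|\int_0^x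 f_1-\int_0^x f_2\right|$. **Theorem.** Let $f^*$ be a probability density on $[0,1)$ with $\int_0^1 f^*(x)\log f^*(x)\,\mathrm dx<\infty$, and let $Z_1,Z_2,\dots$ be i.i.d. with density $f^*$ under $\mathrm P^*$. Suppose that $p_n>0$ for all $n\ge0$, that $\alpha_{x_{1:n}}>0$ and, for GFPT2, $\beta_{x_{1:n}}>0$ for all $n\in\mathbb N$ and $x_{1:n}\in\{0,1\}^n$. Then for every $\varepsilon>0$ and $i=1,2$, $$\mathrm P^*\Big(\lim_{m\to\infty}\Pi_i\big(d_{\mathrm{KS}}(f,f^*)<\varepsilon\mid Z_{1:m}\big)=1\Big)=1 .$$ -/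

import Mathlib

open MeasureTheory ProbabilityTheory Set Filter Topology

namespace PolyaTree

noncomputable section

/-- A finite binary word `x_{1:n} = [x_1, …, x_n]`; the digits `0, 1` are `false, true`, the empty
word is `[]`, and `x_{1:n-1}, k` is `s ++ [k]` with `s = x_{1:n-1}`. -/
abbrev Word := List Bool

/-- The first `n` digits of an infinite digit sequence, as a word. -/
def prefixWord (x : ℕ → Bool) (n : ℕ) : Word := List.ofFn fun i : Fin n => x i

/-- Nested binary partitions of `[0,1)`: the interval of the word `s` is `[a s, a s + len s)`. -/
structure NBP where
  a : Word → ℝ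
  len : Word → ℝ
  a_nil : a [] = 0
  len_nil : len [] = 1
  a_mem : ∀ s : Word, s ≠ [] → a s ∈ Ico (0 : ℝ) 1
  len_mem : ∀ s : Word, s ≠ [] → len s ∈ Ioo (0 : ℝ) 1
  a_zero : ∀ s : Word, a (s ++ [false]) = a s
  a_one : ∀ s : Word, a (s ++ [true]) = a (s ++ [false]) + len (s ++ [false])
  len_split : ∀ s : Word, len s = len (s ++ [false]) + len (s ++ [true])

/-- The lengths of the intervals around every point `t ∈ [0,1)` shrink to zero, so that a point is
determined by its digits `x = (x_1, x_2, …)`. -/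
def NBP.Shrinking (I : NBP) : Prop :=
  ∀ t ∈ Ico (0 : ℝ) 1, ∀ x : ℕ → Bool,
    (∀ n, t ∈ Ico (I.a (prefixWord x n)) (I.a (prefixWord x n) + I.len (prefixWord x n))) →
      Tendsto (fun n => I.len (prefixWord x n)) atTop (𝓝 0)

/-- The beta distribution, degenerate at `1` or at `0` if one of its parameters vanishes. -/
def betaLaw (a₀ a₁ : ℝ) : Measure ℝ :=
  if 0 < a₀ ∧ 0 < a₁ then betaMeasure a₀ a₁
  else if 0 < a₀ then Measure.dirac 1 else Measure.dirac 0

instance (a₀ a₁ : ℝ) : IsProbabilityMeasure (betaLaw a₀ a₁) := by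
  unfold betaLaw
  split_ifs with h
  · exact isProbabilityMeasureBeta h.1 h.2
  · infer_instance
  · infer_instance

/-- A beta-distributed sequence is recorded by its independent entries `y s = Y_{s,0}`. -/
abbrev BetaSeq := Word → ℝ

/-- `Y_{s,k}`, where `Y_{s,1} = 1 - Y_{s,0}`. -/
def branch (y : BetaSeq) (s : Word) (k : Bool) : ℝ := if k then 1 - y s else y s

/-- The law of an infinite beta-distributed sequence with parameter `α`: the `Y_{s,0}` are
independent, with `Y_{s,0} ∼ Beta(α_{s,0}, α_{s,1})`. -/
def betaSeqLaw (α : Word → ℝ) : Measure BetaSeq :=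
  Measure.infinitePi fun s : Word => betaLaw (α (s ++ [false])) (α (s ++ [true]))

/-- `∏_{j=1}^n Y_{x_{1:j}}` for the word `w = x_{1:n}`. -/
def pathProd (y : BetaSeq) (w : Word) : ℝ :=
  ∏ j : Fin w.length, branch y (w.take j) w[j]

/-- The function on `[0,1)` that takes the value `∏_{j=1}^n Y_{x_{1:j}} / len_{x_{1:n}}` on the
interval of `x_{1:n}`, for every word `x_{1:n}` of length `n` (and the value `0` off `[0,1)`). -/
def stepDensity (a len : Word → ℝ) (n : ℕ) (y : BetaSeq) (t : ℝ) : ℝ :=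
  ∑ x : Fin n → Bool,
    (Ico (a (List.ofFn x)) (a (List.ofFn x) + len (List.ofFn x))).indicator
      (fun _ => pathProd y (List.ofFn x) / len (List.ofFn x)) t

/-- The random GFPT1 density `f(t ∣ Y^{(N)})` as a function of `θ = (N, Y)`. -/
def density₁ (I : NBP) (θ : ℕ × BetaSeq) : ℝ → ℝ :=
  stepDensity I.a I.len θ.1 θ.2

/-- The GFPT1 prior of `(N, Y)`: independent, `N ∼ p`, `Y` a beta-distributed sequence. -/
def prior₁ (p : PMF ℕ) (α : Word → ℝ) : Measure (ℕ × BetaSeq) :=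
  p.toMeasure.prod (betaSeqLaw α)

/-- The length `L_{x_{1:n}} = ∏_{j=1}^n R_{x_{1:j}}` in the partition given by the length ratios
`R_{x_{1:j}} = L_{x_{1:j}} / L_{x_{1:j-1}}`, `L_∅ = 1`. -/
def randLen (r : BetaSeq) (w : Word) : ℝ := pathProd r w

/-- The left endpoint of the interval of `x_{1:n}` in that partition: the total length of the left
siblings met where a digit is `1`. -/
def randLeft (r : BetaSeq) (w : Word) : ℝ :=
  ∑ j : Fin w.length, if w[j] then randLen r (w.take j ++ [false]) else 0

/-- The random GFPT2 density `f(t ∣ Y^{(N)}, R^{(N)})` as a function of `θ = (N, Y, R)`. -/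
def density₂ (θ : ℕ × BetaSeq × BetaSeq) : ℝ → ℝ :=
  stepDensity (randLeft θ.2.2) (randLen θ.2.2) θ.1 θ.2.1

/-- The GFPT2 prior of `(N, Y, R)`: independent, `N ∼ p`, `Y` and `R` beta-distributed sequences
with parameters `α` and `β`. -/
def prior₂ (p : PMF ℕ) (α β : Word → ℝ) : Measure (ℕ × BetaSeq × BetaSeq) :=
  p.toMeasure.prod ((betaSeqLaw α).prod (betaSeqLaw β))

/-- The joint law of `(θ, Z_{1:m})` in the model `θ ∼ prior`, `Z_1, …, Z_m ∣ θ` i.i.d. with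
density `f θ` on `[0,1)`. -/
def modelLaw {Θ : Type*} [MeasurableSpace Θ] (prior : Measure Θ) (f : Θ → ℝ → ℝ) (m : ℕ) :
    Measure (Θ × (Fin m → ℝ)) :=
  (prior.prod (Measure.pi fun _ : Fin m => volume.restrict (Ico (0 : ℝ) 1))).withDensity
    fun q => ∏ i : Fin m, ENNReal.ofReal (f q.1 (q.2 i))

/-- `Q z = Π(· ∣ Z_{1:m} = z)` is (a version of) the posterior distribution: the regular conditional
distribution of `θ` given `Z_{1:m}` under the model. -/
def IsPosterior {Θ : Type*} [MeasurableSpace Θ] (prior : Measure Θ) (f : Θ → ℝ → ℝ) (m : ℕ)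
    (Q : Kernel (Fin m → ℝ) Θ) : Prop :=
  IsMarkovKernel Q ∧
    (modelLaw prior f m).map Prod.swap = ((modelLaw prior f m).map Prod.snd) ⊗ₘ Q

/-- `f` is a probability density on `[0,1)`. -/
structure IsPDF (f : ℝ → ℝ) : Prop where
  measurable : Measurable f
  nonneg : ∀ t ∈ Ico (0 : ℝ) 1, 0 ≤ f t
  lintegral_eq_one : ∫⁻ t in Ico (0 : ℝ) 1, ENNReal.ofReal (f t) = 1

/-- The probability measure on `[0,1)` with density `f`. -/
def pdfLaw (f : ℝ → ℝ) : Measure ℝ :=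
  (volume.restrict (Ico (0 : ℝ) 1)).withDensity fun t => ENNReal.ofReal (f t)

/-- The Kolmogorov–Smirnov distance of two densities on `[0,1)`. -/
def dKS (f₁ f₂ : ℝ → ℝ) : ℝ :=
  sSup ((fun x => |(∫ t in (0 : ℝ)..x, f₁ t) - ∫ t in (0 : ℝ)..x, f₂ t|) '' Ico (0 : ℝ) 1)

/-- Almost surely, the posterior mass of the Kolmogorov–Smirnov `ε`-ball around `fstar` tends to
`1` as the sample size `m` tends to infinity, whichever version `Q m` of the posterior given
`Z_1, …, Z_m` is used. -/
def KSConsistent {Ω Θ : Type*} [MeasurableSpace Ω] [MeasurableSpace Θ] (P : Measure Ω)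
    (Z : ℕ → Ω → ℝ) (fstar : ℝ → ℝ) (prior : Measure Θ) (f : Θ → ℝ → ℝ) (ε : ℝ) : Prop :=
  ∀ Q : (m : ℕ) → Kernel (Fin m → ℝ) Θ, (∀ m, IsPosterior prior f m (Q m)) →
    ∀ᵐ ω ∂P, Tendsto (fun m : ℕ => Q m (fun i : Fin m => Z i ω) {θ | dKS (f θ) fstar < ε})
      atTop (𝓝 1)

end

end PolyaTree

open PolyaTree

/-!
# Posterior consistency of Pólya-tree-type step densities in the Kolmogorov–Smirnov distance

The proof is Schwartz's: a prior that charges every Kullback–Leibler neighbourhood of the true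
density is consistent for every neighbourhood that statistics of the sample can detect.

* *Bayes' formula.* For Lebesgue almost every sample, any version of the posterior gives `U` the
  mass `N(U) / D`, where `N(U)` is the likelihood integrated over `U` and `D` the likelihood
  integrated over all parameters (`IsPosterior.mul_lintegral_likelihood`). The true law of the sample
  is absolutely continuous, so this holds along the data.
* *Numerator.* Suppose that the mean of a statistic `g` with `|g| ≤ 1` is at least `δ` larger under
  each `f θ`, `θ ∈ U`, than under `fstar`. Tilting the likelihood by the product of the factors
  `exp (-l (g z - c))` makes its mean exponentially small, while by the law of large numbers the
  tilting factor is eventually at least one. By Borel–Cantelli, `N(U)` is exponentially smaller than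
  the likelihood of `fstar` (`ae_eventually_setLIntegral_likelihood_le`).
* *Denominator.* If a set of positive prior mass has densities above a common bound `h` whose
  Kullback–Leibler divergence from `fstar` is below `η`, then `D` exceeds `exp (-η m)` times the
  likelihood of `fstar`, up to a constant
  (`KLSupported.ae_eventually_le_lintegral_likelihood`).
* *Distance.* The distribution function of `fstar` is continuous, so a Kolmogorov–Smirnov ball
  contains the densities whose distribution functions are close to it on a finite grid, and the
  complement is covered by finitely many sets `U` as above (`IsPDF.exists_finset_dKS_lt`).

It remains to see that both priors charge such neighbourhoods. On a shrinking partition, the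
level-`n` averages of `fstar` converge to it almost everywhere. With a small uniform component mixed
in, Fatou's lemma turns this into approximation in Kullback–Leibler divergence by step densities with
branch weights in `(0, 1)` (`NBP.Shrinking.exists_lt_integral_mul_log_stepDensity`), and
beta-distributed sequences have full support (`betaSeqLaw_pos_of_isOpen`). For the prior with a
random partition the approximation is done on the dyadic partition. Nearby partitions give the same
step density up to a constant factor, except close to the finitely many dyadic end points, where the
smallest value of the step density serves as the lower bound.
-/

namespace PolyaTree

/-! ### Words, path products and nested binary partitions -/

theorem pathProd_nil (y : BetaSeq) : pathProd y [] = 1 := by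
  simp [pathProd]

theorem pathProd_eq_prod_range (y : BetaSeq) (w : Word) :
    pathProd y w = ∏ j ∈ Finset.range w.length, branch y (w.take j) (w.getD j false) := by
  rw [Finset.prod_range, pathProd]
  exact Finset.prod_congr rfl fun j _ => by simp

theorem pathProd_append_singleton (y : BetaSeq) (s : Word) (k : Bool) :
    pathProd y (s ++ [k]) = pathProd y s * branch y s k := by
  rw [pathProd_eq_prod_range, pathProd_eq_prod_range, List.length_append, List.length_singleton,
    Finset.prod_range_succ]
  congr 1
  · refine Finset.prod_congr rfl fun j hj => ?_
    have hj' : j < s.length := Finset.mem_range.1 hj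
    rw [List.take_append_of_le_length hj'.le, List.getD_append _ _ _ _ hj']
  · simp

theorem randLeft_nil (r : BetaSeq) : randLeft r [] = 0 := by
  simp [randLeft]

theorem randLeft_eq_sum_range (r : BetaSeq) (w : Word) :
    randLeft r w = ∑ j ∈ Finset.range w.length,
      if w.getD j false then randLen r (w.take j ++ [false]) else 0 := by
  rw [Finset.sum_range, randLeft]
  exact Finset.sum_congr rfl fun j _ => by simp

theorem randLeft_append_singleton (r : BetaSeq) (s : Word) (k : Bool) :
    randLeft r (s ++ [k]) = randLeft r s + if k then randLen r (s ++ [false]) else 0 := by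
  rw [randLeft_eq_sum_range, randLeft_eq_sum_range, List.length_append, List.length_singleton,
    Finset.sum_range_succ]
  congr 1
  · refine Finset.sum_congr rfl fun j hj => ?_
    have hj' : j < s.length := Finset.mem_range.1 hj
    rw [List.take_append_of_le_length hj'.le, List.getD_append _ _ _ _ hj']
  · simp

theorem branch_pos {y : BetaSeq} (hy : ∀ s, y s ∈ Ioo (0 : ℝ) 1) (s : Word) (k : Bool) :
    0 < branch y s k := by
  have := hy s
  unfold branch
  split_ifs
  · linarith [this.2]
  · exact this.1

theorem branch_lt_one {y : BetaSeq} (hy : ∀ s, y s ∈ Ioo (0 : ℝ) 1) (s : Word) (k : Bool) :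
    branch y s k < 1 := by
  have := hy s
  unfold branch
  split_ifs
  · linarith [this.1]
  · exact this.2

theorem pathProd_pos {y : BetaSeq} (hy : ∀ s, y s ∈ Ioo (0 : ℝ) 1) (w : Word) :
    0 < pathProd y w :=
  Finset.prod_pos fun _ _ => branch_pos hy _ _

theorem ofFn_snoc {n : ℕ} (x : Fin n → Bool) (k : Bool) :
    List.ofFn (Fin.snoc x k : Fin (n + 1) → Bool) = List.ofFn x ++ [k] := by
  rw [List.ofFn_succ', List.concat_eq_append]
  simp

theorem sum_pathProd (y : BetaSeq) (n : ℕ) :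
    ∑ x : Fin n → Bool, pathProd y (List.ofFn x) = 1 := by
  induction n with
  | zero => simp [pathProd_nil]
  | succ n ih =>
    rw [← Equiv.sum_comp (Fin.snocEquiv fun _ : Fin (n + 1) => Bool), Fintype.sum_prod_type_right,
      ← ih]
    refine Finset.sum_congr rfl fun x _ => ?_
    simp only [Fin.snocEquiv, Equiv.coe_fn_mk, Fintype.sum_bool, ofFn_snoc,
      pathProd_append_singleton, branch]
    simp only [if_true, Bool.false_eq_true, if_false]
    ring

theorem continuous_branch (s : Word) (k : Bool) : Continuous fun y : BetaSeq => branch y s k := by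
  have h : Continuous fun y : BetaSeq => y s := continuous_apply s
  unfold branch
  cases k
  · simpa using h
  · simp only [if_true]
    fun_prop

theorem continuous_pathProd (w : Word) : Continuous fun y : BetaSeq => pathProd y w :=
  continuous_finsetProd _ fun _ _ => continuous_branch _ _

theorem continuous_randLen (w : Word) : Continuous fun r : BetaSeq => randLen r w :=
  continuous_pathProd w

theorem continuous_randLeft (w : Word) : Continuous fun r : BetaSeq => randLeft r w := by
  refine continuous_finsetSum _ fun j _ => ?_
  split_ifs
  · exact continuous_randLen _
  · exact continuous_const

/-- Joint measurability of the step densities in the partition, the branch weights and the point. -/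
theorem measurable_stepDensity {X : Type*} [MeasurableSpace X] {a len : X → Word → ℝ}
    {y : X → BetaSeq} {t : X → ℝ} (ha : ∀ w, Measurable fun x => a x w)
    (hlen : ∀ w, Measurable fun x => len x w) (hy : Measurable y) (ht : Measurable t) (n : ℕ) :
    Measurable fun x => stepDensity (a x) (len x) n (y x) (t x) := by
  unfold stepDensity
  refine Finset.measurable_sum _ fun w _ => ?_
  have h1 : MeasurableSet {x | t x ∈ Ico (a x (List.ofFn w)) (a x (List.ofFn w) +
      len x (List.ofFn w))} :=
    (measurableSet_le (ha _) ht).inter (measurableSet_lt ht ((ha _).add (hlen _)))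
  have h2 : Measurable fun x => pathProd (y x) (List.ofFn w) / len x (List.ofFn w) :=
    ((continuous_pathProd _).measurable.comp hy).div (hlen _)
  exact h2.indicator h1

namespace NBP

theorem len_pos (I : NBP) (s : Word) : 0 < I.len s := by
  rcases eq_or_ne s [] with rfl | h
  · simp [I.len_nil]
  · exact (I.len_mem s h).1

/-- The word of length `n` whose interval contains `t`: bisection of the partition `I` at `t`. -/
noncomputable def locate (I : NBP) (t : ℝ) : ℕ → Word
  | 0 => []
  | n + 1 => I.locate t n ++ [decide (I.a (I.locate t n ++ [true]) ≤ t)]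

theorem mem_locate (I : NBP) {t : ℝ} (ht : t ∈ Ico (0 : ℝ) 1) (n : ℕ) :
    t ∈ Ico (I.a (I.locate t n)) (I.a (I.locate t n) + I.len (I.locate t n)) := by
  induction n with
  | zero => simpa [locate, I.a_nil, I.len_nil] using ht
  | succ n ih =>
    set s := I.locate t n with hs
    have h0 := I.a_zero s
    have h1 := I.a_one s
    have h2 := I.len_split s
    by_cases h : I.a (s ++ [true]) ≤ t
    · have hw : I.locate t (n + 1) = s ++ [true] := by simp [locate, ← hs, h]
      rw [hw]
      exact ⟨h, by linarith [ih.2]⟩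
    · have hw : I.locate t (n + 1) = s ++ [false] := by simp [locate, ← hs, h]
      rw [hw]
      exact ⟨by linarith [ih.1], by linarith [not_le.1 h]⟩

theorem locate_eq (I : NBP) {t : ℝ} {s : Word} (ht : t ∈ Ico (I.a s) (I.a s + I.len s)) :
    I.locate t s.length = s := by
  induction s using List.reverseRecOn with
  | nil => rfl
  | append_singleton s k ih =>
    have h0 := I.a_zero s
    have h1 := I.a_one s
    have h2 := I.len_split s
    have p0 := I.len_pos (s ++ [false])
    have p1 := I.len_pos (s ++ [true])
    cases k
    · have := ih ⟨by linarith [ht.1], by linarith [ht.2]⟩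
      have h : ¬ I.a (s ++ [true]) ≤ t := by linarith [ht.2]
      simp [locate, this, h]
    · have := ih ⟨by linarith [ht.1], by linarith [ht.2]⟩
      have h : I.a (s ++ [true]) ≤ t := ht.1
      simp [locate, this, h]

theorem prefixWord_locate (I : NBP) (t : ℝ) (n : ℕ) :
    prefixWord (fun i => decide (I.a (I.locate t i ++ [true]) ≤ t)) n = I.locate t n := by
  induction n with
  | zero => simp [prefixWord, locate]
  | succ n ih =>
    rw [locate, ← ih, prefixWord, List.ofFn_succ', List.concat_eq_append, ih]
    congr 1

theorem exists_ofFn_eq_locate (I : NBP) (t : ℝ) (n : ℕ) :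
    ∃ x : Fin n → Bool, List.ofFn x = I.locate t n :=
  ⟨_, I.prefixWord_locate t n⟩

theorem Shrinking.tendsto_len_locate {I : NBP} (hI : I.Shrinking) {t : ℝ}
    (ht : t ∈ Ico (0 : ℝ) 1) : Tendsto (fun n => I.len (I.locate t n)) atTop (𝓝 0) := by
  have := hI t ht (fun i => decide (I.a (I.locate t i ++ [true]) ≤ t)) fun n => by
    rw [prefixWord_locate]
    exact I.mem_locate ht n
  simpa only [prefixWord_locate] using this

theorem stepDensity_eq (I : NBP) (n : ℕ) (y : BetaSeq) {t : ℝ} (ht : t ∈ Ico (0 : ℝ) 1) :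
    stepDensity I.a I.len n y t = pathProd y (I.locate t n) / I.len (I.locate t n) := by
  obtain ⟨x, hx⟩ := I.exists_ofFn_eq_locate t n
  rw [stepDensity, Finset.sum_eq_single x]
  · rw [hx, indicator_of_mem (I.mem_locate ht n)]
  · intro x' _ hne
    refine indicator_of_notMem (fun h => hne ?_) _
    have := I.locate_eq h
    rw [List.length_ofFn] at this
    exact List.ofFn_injective (this.symm.trans hx.symm)
  · simp

theorem stepDensity_pos (I : NBP) (n : ℕ) {y : BetaSeq} (hy : ∀ s, y s ∈ Ioo (0 : ℝ) 1) {t : ℝ}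
    (ht : t ∈ Ico (0 : ℝ) 1) : 0 < stepDensity I.a I.len n y t := by
  rw [I.stepDensity_eq n y ht]
  exact div_pos (pathProd_pos hy _) (I.len_pos _)

theorem measurable_stepDensity (I : NBP) (n : ℕ) (y : BetaSeq) :
    Measurable (stepDensity I.a I.len n y) :=
  PolyaTree.measurable_stepDensity (a := fun _ => I.a) (len := fun _ => I.len) (y := fun _ => y)
    (fun _ => measurable_const) (fun _ => measurable_const) measurable_const measurable_id n

theorem lintegral_stepDensity_le (I : NBP) (n : ℕ) {y : BetaSeq}
    (hy : ∀ s, y s ∈ Ioo (0 : ℝ) 1) :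
    ∫⁻ t in Ico (0 : ℝ) 1, ENNReal.ofReal (stepDensity I.a I.len n y t) ≤ 1 := by
  have hpos : ∀ x : Fin n → Bool, 0 ≤ pathProd y (List.ofFn x) / I.len (List.ofFn x) := fun x =>
    div_nonneg (pathProd_pos hy _).le (I.len_pos _).le
  calc ∫⁻ t in Ico (0 : ℝ) 1, ENNReal.ofReal (stepDensity I.a I.len n y t)
      ≤ ∫⁻ t, ENNReal.ofReal (stepDensity I.a I.len n y t) := setLIntegral_le_lintegral _ _
    _ = ∫⁻ t, ∑ x : Fin n → Bool,
          (Ico (I.a (List.ofFn x)) (I.a (List.ofFn x) + I.len (List.ofFn x))).indicator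
            (fun _ => ENNReal.ofReal (pathProd y (List.ofFn x) / I.len (List.ofFn x))) t := by
        refine lintegral_congr fun t => ?_
        rw [stepDensity, ENNReal.ofReal_sum_of_nonneg]
        · refine Finset.sum_congr rfl fun x _ => ?_
          by_cases h : t ∈ Ico (I.a (List.ofFn x)) (I.a (List.ofFn x) + I.len (List.ofFn x))
          · simp only [indicator_of_mem h]
          · simp only [indicator_of_notMem h, ENNReal.ofReal_zero]
        · exact fun x _ => indicator_nonneg (fun _ _ => hpos x) _
    _ = ∑ x : Fin n → Bool, ENNReal.ofReal (pathProd y (List.ofFn x)) := by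
        rw [lintegral_finsetSum _ fun x _ => measurable_const.indicator measurableSet_Ico]
        refine Finset.sum_congr rfl fun x _ => ?_
        rw [lintegral_indicator measurableSet_Ico, setLIntegral_const, Real.volume_Ico,
          add_sub_cancel_left, ← ENNReal.ofReal_mul (hpos x),
          div_mul_cancel₀ _ (I.len_pos _).ne']
    _ = 1 := by
        rw [← ENNReal.ofReal_sum_of_nonneg fun x _ => (pathProd_pos hy _).le, sum_pathProd,
          ENNReal.ofReal_one]

theorem exists_bounds_stepDensity (I : NBP) (n : ℕ) {y : BetaSeq}
    (hy : ∀ s, y s ∈ Ioo (0 : ℝ) 1) :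
    ∃ b C : ℝ, 0 < b ∧
      (∀ x : Fin n → Bool, pathProd y (List.ofFn x) / I.len (List.ofFn x) ∈ Icc b C) ∧
      ∀ t ∈ Ico (0 : ℝ) 1, stepDensity I.a I.len n y t ∈ Icc b C := by
  set v : (Fin n → Bool) → ℝ := fun x => pathProd y (List.ofFn x) / I.len (List.ofFn x) with hv
  have hpos : ∀ x, 0 < v x := fun x => div_pos (pathProd_pos hy _) (I.len_pos _)
  obtain ⟨x₀, h₀⟩ := Finite.exists_min v
  obtain ⟨x₁, h₁⟩ := Finite.exists_max v
  refine ⟨v x₀, v x₁, hpos x₀, fun x => ⟨h₀ x, h₁ x⟩, fun t ht => ?_⟩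
  obtain ⟨x, hx⟩ := I.exists_ofFn_eq_locate t n
  rw [I.stepDensity_eq n y ht, ← hx]
  exact ⟨h₀ x, h₁ x⟩

theorem a_nonneg_and_a_add_len_le_one (I : NBP) (s : Word) : 0 ≤ I.a s ∧ I.a s + I.len s ≤ 1 := by
  induction s using List.reverseRecOn with
  | nil => simp [I.a_nil, I.len_nil]
  | append_singleton s k ih =>
    have h0 := I.a_zero s
    have h1 := I.a_one s
    have h2 := I.len_split s
    have p0 := I.len_pos (s ++ [false])
    have p1 := I.len_pos (s ++ [true])
    cases k <;> constructor <;> linarith [ih.1, ih.2]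

/-- The nested binary partition whose relative interval lengths are the numbers `r s ∈ (0, 1)`. -/
noncomputable def ofRatio (r : BetaSeq) (hr : ∀ s, r s ∈ Ioo (0 : ℝ) 1) : NBP where
  a := randLeft r
  len := randLen r
  a_nil := randLeft_nil r
  len_nil := pathProd_nil r
  a_mem s hs := by
    clear hs
    have hpos : ∀ s, 0 < randLen r s := pathProd_pos hr
    suffices h : 0 ≤ randLeft r s ∧ randLeft r s + randLen r s ≤ 1 from
      ⟨h.1, by linarith [hpos s, h.2]⟩
    induction s using List.reverseRecOn with
    | nil => simp [randLeft_nil, randLen, pathProd_nil]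
    | append_singleton s k ih =>
      have h0 : randLen r (s ++ [false]) = randLen r s * r s := by
        simp [randLen, pathProd_append_singleton, branch]
      have h1 : randLen r (s ++ [true]) = randLen r s * (1 - r s) := by
        simp [randLen, pathProd_append_singleton, branch]
      have p0 := hpos (s ++ [false])
      have p1 := hpos (s ++ [true])
      have hs : randLen r (s ++ [false]) + randLen r (s ++ [true]) = randLen r s := by
        rw [h0, h1]; ring
      rw [randLeft_append_singleton]
      cases k
      · simp only [Bool.false_eq_true, if_false]
        exact ⟨by linarith [ih.1], by linarith [ih.2]⟩
      · simp only [if_true]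
        exact ⟨by linarith [ih.1], by linarith [ih.2]⟩
  len_mem s hs := by
    refine ⟨pathProd_pos hr s, ?_⟩
    induction s using List.reverseRecOn with
    | nil => exact absurd rfl hs
    | append_singleton s k ih =>
      have hb := branch_lt_one hr s k
      have hb' := branch_pos hr s k
      rw [randLen, pathProd_append_singleton]
      rcases eq_or_ne s [] with rfl | h
      · simpa [pathProd_nil] using hb
      · exact mul_lt_one_of_nonneg_of_lt_one_left (pathProd_pos hr s).le (ih h) hb.le
  a_zero s := by simp [randLeft_append_singleton]
  a_one s := by simp [randLeft_append_singleton]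
  len_split s := by
    simp only [randLen, pathProd_append_singleton, branch, Bool.false_eq_true, if_true, if_false]
    ring

end NBP

/-- The dyadic partition, with all relative interval lengths equal to `1 / 2`. -/
noncomputable def dyadic : NBP := NBP.ofRatio (fun _ => 1 / 2) fun _ => by norm_num

theorem shrinking_dyadic : dyadic.Shrinking := by
  intro t _ x _
  have hlen : ∀ w : Word, dyadic.len w = (1 / 2 : ℝ) ^ w.length := by
    intro w
    change pathProd (fun _ => 1 / 2) w = _
    induction w using List.reverseRecOn with
    | nil => simp [pathProd_nil]
    | append_singleton s k ih =>
      rw [pathProd_append_singleton, ih, List.length_append, List.length_singleton, pow_succ]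
      congr 1
      unfold branch
      split_ifs <;> norm_num
  simp only [hlen, prefixWord, List.length_ofFn]
  exact tendsto_pow_atTop_nhds_zero_of_lt_one (by norm_num) (by norm_num)

/-! ### Densities, samples and likelihoods -/

theorem IsPDF.integrableOn {f : ℝ → ℝ} (hf : IsPDF f) : IntegrableOn f (Ico 0 1) := by
  refine ⟨hf.measurable.aestronglyMeasurable, ?_⟩
  rw [hasFiniteIntegral_iff_ofReal, hf.lintegral_eq_one]
  · exact ENNReal.one_lt_top
  · exact (ae_restrict_iff' measurableSet_Ico).2 (ae_of_all _ hf.nonneg)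

theorem IsPDF.integral_eq_one {f : ℝ → ℝ} (hf : IsPDF f) : ∫ t in Ico (0 : ℝ) 1, f t = 1 := by
  rw [integral_eq_lintegral_of_nonneg_ae
    ((ae_restrict_iff' measurableSet_Ico).2 (ae_of_all _ hf.nonneg))
    hf.measurable.aestronglyMeasurable, hf.lintegral_eq_one, ENNReal.toReal_one]

theorem lintegral_pdfLaw {f : ℝ → ℝ} (hf : Measurable f) {g : ℝ → ENNReal} (hg : Measurable g) :
    ∫⁻ z, g z ∂pdfLaw f = ∫⁻ z in Ico (0 : ℝ) 1, ENNReal.ofReal (f z) * g z := by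
  rw [pdfLaw, lintegral_withDensity_eq_lintegral_mul _ hf.ennreal_ofReal hg]
  rfl

theorem integral_pdfLaw {f : ℝ → ℝ} (hf : IsPDF f) (g : ℝ → ℝ) :
    ∫ z, g z ∂pdfLaw f = ∫ z in Ico (0 : ℝ) 1, f z * g z := by
  rw [pdfLaw, integral_withDensity_eq_integral_toReal_smul hf.measurable.ennreal_ofReal
    (ae_of_all _ fun _ => ENNReal.ofReal_lt_top)]
  refine setIntegral_congr_fun measurableSet_Ico fun z hz => ?_
  simp only [ENNReal.toReal_ofReal (hf.nonneg z hz), smul_eq_mul]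

theorem integrable_pdfLaw {f : ℝ → ℝ} (hf : IsPDF f) {g : ℝ → ℝ}
    (hg : IntegrableOn (fun z => f z * g z) (Ico 0 1)) : Integrable g (pdfLaw f) := by
  rw [pdfLaw, integrable_withDensity_iff_integrable_smul' hf.measurable.ennreal_ofReal
    (ae_of_all _ fun _ => ENNReal.ofReal_lt_top)]
  refine hg.congr_fun (fun z hz => ?_) measurableSet_Ico
  simp only [ENNReal.toReal_ofReal (hf.nonneg z hz), smul_eq_mul]

theorem ae_pdfLaw {f : ℝ → ℝ} (hf : Measurable f) :
    ∀ᵐ z ∂pdfLaw f, z ∈ Ico (0 : ℝ) 1 ∧ 0 < f z := by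
  rw [pdfLaw, ae_withDensity_iff hf.ennreal_ofReal]
  filter_upwards [ae_restrict_mem measurableSet_Ico] with z hz h
  exact ⟨hz, by simpa using h⟩

instance : IsProbabilityMeasure (volume.restrict (Ico (0 : ℝ) 1)) := ⟨by simp⟩

/-- The product of copies of `pdfLaw f` has the product density, hence it is absolutely continuous
with respect to Lebesgue measure on the cube. -/
theorem pi_pdfLaw_absolutelyContinuous {f : ℝ → ℝ} (hf : IsPDF f) (m : ℕ) :
    (Measure.pi fun _ : Fin m => pdfLaw f) ≪
      Measure.pi fun _ : Fin m => volume.restrict (Ico (0 : ℝ) 1) := by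
  set μ : Measure (Fin m → ℝ) := Measure.pi fun _ : Fin m => volume.restrict (Ico (0 : ℝ) 1)
  have : IsProbabilityMeasure (pdfLaw f) :=
    ⟨by rw [pdfLaw, withDensity_apply _ .univ, setLIntegral_univ, hf.lintegral_eq_one]⟩
  suffices h : (Measure.pi fun _ : Fin m => pdfLaw f) =
      μ.withDensity fun z => ∏ i, ENNReal.ofReal (f (z i)) by
    rw [h]
    exact withDensity_absolutelyContinuous _ _
  refine Measure.pi_eq fun s hs => ?_
  have hind : iIndepFun (fun (i : Fin m) (z : Fin m → ℝ) =>
      (s i).indicator (fun t => ENNReal.ofReal (f t)) (z i)) μ :=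
    iIndepFun_pi (μ := fun _ : Fin m => volume.restrict (Ico (0 : ℝ) 1))
      (X := fun i => (s i).indicator fun t => ENNReal.ofReal (f t))
      fun i => (hf.measurable.ennreal_ofReal.indicator (hs i)).aemeasurable
  rw [withDensity_apply _ (MeasurableSet.univ_pi hs),
    ← lintegral_indicator (MeasurableSet.univ_pi hs)]
  have h1 : ∀ z : Fin m → ℝ, (univ.pi s).indicator (fun z => ∏ i, ENNReal.ofReal (f (z i))) z =
      ∏ i, (s i).indicator (fun t => ENNReal.ofReal (f t)) (z i) := by
    intro z
    by_cases hz : z ∈ univ.pi s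
    · rw [indicator_of_mem hz]
      exact Finset.prod_congr rfl fun i _ => by rw [indicator_of_mem (hz i trivial)]
    · rw [indicator_of_notMem hz]
      obtain ⟨i, hi⟩ : ∃ i, z i ∉ s i := by simpa [mem_univ_pi] using hz
      exact (Finset.prod_eq_zero (Finset.mem_univ i) (indicator_of_notMem hi _)).symm
  rw [lintegral_congr h1, lintegral_prod_eq_prod_lintegral_of_indepFun _ _ hind fun i =>
    (hf.measurable.ennreal_ofReal.indicator (hs i)).comp (measurable_pi_apply i)]
  refine Finset.prod_congr rfl fun i _ => ?_
  rw [(measurePreserving_eval (fun _ : Fin m => volume.restrict (Ico (0 : ℝ) 1)) i).lintegral_comp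
    (hf.measurable.ennreal_ofReal.indicator (hs i)), lintegral_indicator (hs i), pdfLaw,
    withDensity_apply _ (hs i)]

/-- The likelihood `∏ f_θ(z_i)` of the sample `z`. -/
noncomputable def likelihood {Θ : Type*} (f : Θ → ℝ → ℝ) {m : ℕ} (z : Fin m → ℝ) (θ : Θ) :
    ENNReal :=
  ∏ i, ENNReal.ofReal (f θ (z i))

theorem measurable_likelihood {Θ : Type*} [MeasurableSpace Θ] {f : Θ → ℝ → ℝ}
    (hf : Measurable (Function.uncurry f)) (m : ℕ) :
    Measurable fun q : Θ × (Fin m → ℝ) => likelihood f q.2 q.1 :=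
  Finset.measurable_prod _ fun i _ => (hf.comp
    (measurable_fst.prodMk ((measurable_pi_apply i).comp measurable_snd))).ennreal_ofReal

/-- **Bayes' formula**, in multiplicative form: for Lebesgue almost every sample in the cube, every
version of the posterior is proportional to the likelihood. -/
theorem IsPosterior.mul_lintegral_likelihood {Θ : Type*} [MeasurableSpace Θ] {prior : Measure Θ}
    [IsProbabilityMeasure prior] {f : Θ → ℝ → ℝ} (hf : Measurable (Function.uncurry f)) {m : ℕ}
    {Q : Kernel (Fin m → ℝ) Θ} (hQ : IsPosterior prior f m Q) {U : Set Θ}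
    (hU : MeasurableSet U) :
    ∀ᵐ z ∂Measure.pi fun _ : Fin m => volume.restrict (Ico (0 : ℝ) 1),
      Q z U * ∫⁻ θ, likelihood f z θ ∂prior = ∫⁻ θ in U, likelihood f z θ ∂prior := by
  set μ : Measure (Fin m → ℝ) := Measure.pi fun _ : Fin m => volume.restrict (Ico (0 : ℝ) 1)
  have hL := measurable_likelihood hf m
  have hD : ∀ U : Set Θ, Measurable fun z : Fin m → ℝ => ∫⁻ θ in U, likelihood f z θ ∂prior :=
    fun U => hL.lintegral_prod_left' (μ := prior.restrict U)
  obtain ⟨_, hdis⟩ := hQ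
  have hmod : ∀ {U : Set Θ} {B : Set (Fin m → ℝ)}, MeasurableSet U → MeasurableSet B →
      modelLaw prior f m (U ×ˢ B) = ∫⁻ z in B, ∫⁻ θ in U, likelihood f z θ ∂prior ∂μ := by
    intro U B hU hB
    rw [modelLaw, withDensity_apply _ (hU.prod hB), ← Measure.prod_restrict]
    exact lintegral_prod_symm' _ hL
  have hM : (modelLaw prior f m).map Prod.snd =
      μ.withDensity fun z => ∫⁻ θ, likelihood f z θ ∂prior := by
    ext B hB
    rw [Measure.map_apply measurable_snd hB, ← univ_prod, hmod .univ hB, withDensity_apply _ hB]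
    simp only [Measure.restrict_univ]
  refine ae_eq_of_forall_setLIntegral_eq_of_sigmaFinite
    ((Q.measurable_coe hU).mul (by simpa using hD univ)) (hD U) fun B hB _ => ?_
  have h := DFunLike.congr_fun hdis (B ×ˢ U)
  rw [Measure.map_apply measurable_swap (hB.prod hU), preimage_swap_prod, hmod hU hB, hM,
    Measure.compProd_apply_prod hB hU,
    setLIntegral_withDensity_eq_setLIntegral_mul _ (by simpa using hD univ) (Q.measurable_coe hU) hB]
    at h
  rw [h]
  exact lintegral_congr fun z => mul_comm _ _

section Sample

variable {Ω : Type*} [MeasurableSpace Ω] {P : Measure Ω}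
  {fstar : ℝ → ℝ} {Z : ℕ → Ω → ℝ}

theorem map_sample_absolutelyContinuous [IsProbabilityMeasure P] (hfstar : IsPDF fstar)
    (hZ_meas : ∀ i, Measurable (Z i))
    (hZ_law : ∀ i, P.map (Z i) = pdfLaw fstar) (hZ_indep : iIndepFun Z P) (m : ℕ) :
    P.map (fun ω (i : Fin m) => Z i ω) ≪
      Measure.pi fun _ : Fin m => volume.restrict (Ico (0 : ℝ) 1) := by
  have h := (iIndepFun_iff_map_fun_eq_pi_map (f := fun i : Fin m => Z i)
    fun i => (hZ_meas i).aemeasurable).1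
    (hZ_indep.precomp (g := fun i : Fin m => (i : ℕ)) Fin.val_injective)
  rw [h]
  simp only [hZ_law]
  exact pi_pdfLaw_absolutelyContinuous hfstar m

theorem ae_forall_sample_mem (hfstar : IsPDF fstar) (hZ_meas : ∀ i, Measurable (Z i))
    (hZ_law : ∀ i, P.map (Z i) = pdfLaw fstar) :
    ∀ᵐ ω ∂P, ∀ i, Z i ω ∈ Ico (0 : ℝ) 1 ∧ 0 < fstar (Z i ω) := by
  refine ae_all_iff.2 fun i => ?_
  have := ae_pdfLaw hfstar.measurable
  rw [← hZ_law i] at this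
  exact ae_of_ae_map (hZ_meas i).aemeasurable this

/-- The strong law of large numbers for a statistic of the sample. -/
theorem ae_tendsto_sum_sample_div (hfstar : IsPDF fstar) (hZ_meas : ∀ i, Measurable (Z i))
    (hZ_law : ∀ i, P.map (Z i) = pdfLaw fstar) (hZ_indep : iIndepFun Z P) {φ : ℝ → ℝ}
    (hφ : Measurable φ) (hint : IntegrableOn (fun z => fstar z * φ z) (Ico 0 1)) :
    ∀ᵐ ω ∂P, Tendsto (fun m : ℕ => (∑ i : Fin m, φ (Z i ω)) / m) atTop
      (𝓝 (∫ z in Ico (0 : ℝ) 1, fstar z * φ z)) := by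
  have h0 : Integrable (fun ω => φ (Z 0 ω)) P := by
    have := integrable_pdfLaw hfstar hint
    rw [← hZ_law 0] at this
    exact this.comp_measurable (hZ_meas 0)
  have h := strong_law_ae_real (fun i ω => φ (Z i ω)) h0
    (fun i j hij => (hZ_indep.indepFun hij).comp hφ hφ)
    (fun i => (IdentDistrib.comp ⟨(hZ_meas i).aemeasurable, (hZ_meas 0).aemeasurable,
      by rw [hZ_law i, hZ_law 0]⟩ hφ))
  have he : ∫ ω, φ (Z 0 ω) ∂P = ∫ z in Ico (0 : ℝ) 1, fstar z * φ z := by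
    rw [← integral_pdfLaw hfstar, ← hZ_law 0,
      integral_map (hZ_meas 0).aemeasurable hφ.aestronglyMeasurable]
  rw [he] at h
  filter_upwards [h] with ω hω
  simpa only [Finset.sum_range] using hω

/-- If every factor has mean at most `ρ`, then the mixture of the products over the sample decays
faster than `r ^ m` for each `r > ρ`, by Markov's inequality and Borel–Cantelli. -/
theorem ae_eventually_lintegral_prod_le [IsProbabilityMeasure P] (hZ_meas : ∀ i, Measurable (Z i))
    (hZ_law : ∀ i, P.map (Z i) = pdfLaw fstar) (hZ_indep : iIndepFun Z P)
    {Θ : Type*} [MeasurableSpace Θ] {ν : Measure Θ} [SFinite ν] (hν : ν univ ≤ 1)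
    {u : Θ → ℝ → ENNReal} (hu : Measurable (Function.uncurry u)) {ρ r : NNReal} (hρr : ρ < r)
    (hρ : ∀ᵐ θ ∂ν, ∫⁻ z, u θ z ∂pdfLaw fstar ≤ ρ) :
    ∀ᵐ ω ∂P, ∀ᶠ m : ℕ in atTop, ∫⁻ θ, ∏ i : Fin m, u θ (Z i ω) ∂ν ≤ (r : ENNReal) ^ m := by
  have hr0 : r ≠ 0 := (pos_of_gt hρr).ne'
  have huZ : ∀ m : ℕ, Measurable fun q : Ω × Θ => ∏ i : Fin m, u q.2 (Z i q.1) := fun m =>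
    Finset.measurable_prod _ fun i _ =>
      hu.comp (measurable_snd.prodMk ((hZ_meas i).comp measurable_fst))
  set W : ℕ → Ω → ENNReal := fun m ω => ∫⁻ θ, ∏ i : Fin m, u θ (Z i ω) ∂ν with hW
  have hWm : ∀ m, Measurable (W m) := fun m => (huZ m).lintegral_prod_right' (ν := ν)
  have hmean : ∀ m, ∫⁻ ω, W m ω ∂P ≤ (ρ : ENNReal) ^ m := by
    intro m
    rw [lintegral_lintegral_swap (huZ m).aemeasurable]
    calc ∫⁻ θ, ∫⁻ ω, ∏ i : Fin m, u θ (Z i ω) ∂P ∂ν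
        ≤ ∫⁻ _, (ρ : ENNReal) ^ m ∂ν := by
          refine lintegral_mono_ae ?_
          filter_upwards [hρ] with θ hθ
          have huθ : Measurable (u θ) := hu.of_uncurry_left
          have hind : iIndepFun (fun (i : Fin m) ω => u θ (Z i ω)) P :=
            (hZ_indep.precomp (g := fun i : Fin m => (i : ℕ)) Fin.val_injective).comp
              (fun _ => u θ) fun _ => huθ
          rw [lintegral_prod_eq_prod_lintegral_of_indepFun _ _ hind fun i =>
            huθ.comp (hZ_meas i)]
          calc ∏ i : Fin m, ∫⁻ ω, u θ (Z i ω) ∂P ≤ ∏ _i : Fin m, (ρ : ENNReal) := by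
                refine Finset.prod_le_prod' fun i _ => ?_
                rw [← lintegral_map huθ (hZ_meas i), hZ_law]
                exact hθ
            _ = (ρ : ENNReal) ^ m := by simp
      _ ≤ (ρ : ENNReal) ^ m := by
          rw [lintegral_const]
          exact mul_le_of_le_one_right' hν
  have hmarkov : ∀ m, P {ω | (r : ENNReal) ^ m ≤ W m ω} ≤ ((ρ / r : NNReal) : ENNReal) ^ m := by
    intro m
    have hrm : ((r : ENNReal) ^ m) ≠ 0 := pow_ne_zero _ (by simpa using hr0)
    refine (meas_ge_le_lintegral_div (hWm m).aemeasurable hrm (by simp)).trans ?_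
    rw [ENNReal.coe_div hr0, div_eq_mul_inv (ρ : ENNReal), mul_pow, ← ENNReal.inv_pow,
      ← div_eq_mul_inv]
    exact ENNReal.div_le_div_right (hmean m) _
  have hsum : ∑' m, P {ω | (r : ENNReal) ^ m ≤ W m ω} ≠ ⊤ := by
    refine ne_top_of_le_ne_top ?_ (ENNReal.tsum_le_tsum hmarkov)
    rw [ENNReal.tsum_geometric]
    refine ENNReal.inv_ne_top.2 (tsub_pos_iff_lt.2 ?_).ne'
    exact_mod_cast (div_lt_one (pos_of_gt hρr)).2 hρr
  filter_upwards [ae_eventually_notMem hsum] with ω hω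
  filter_upwards [hω] with m hm
  exact (not_le.1 hm).le

end Sample

/-! ### Schwartz's theorem for weak neighbourhoods -/

/-- A nonnegative function on `[0,1)` of total mass at most one. -/
structure IsSubPDF (f : ℝ → ℝ) : Prop where
  measurable : Measurable f
  nonneg : ∀ t ∈ Ico (0 : ℝ) 1, 0 ≤ f t
  lintegral_le_one : ∫⁻ t in Ico (0 : ℝ) 1, ENNReal.ofReal (f t) ≤ 1

theorem IsPDF.isSubPDF {f : ℝ → ℝ} (hf : IsPDF f) : IsSubPDF f :=
  ⟨hf.measurable, hf.nonneg, hf.lintegral_eq_one.le⟩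

theorem IsSubPDF.integrableOn {f : ℝ → ℝ} (hf : IsSubPDF f) : IntegrableOn f (Ico 0 1) := by
  refine ⟨hf.measurable.aestronglyMeasurable, ?_⟩
  rw [hasFiniteIntegral_iff_ofReal]
  · exact hf.lintegral_le_one.trans_lt ENNReal.one_lt_top
  · exact (ae_restrict_iff' measurableSet_Ico).2 (ae_of_all _ hf.nonneg)

theorem IsSubPDF.integral_le_one {f : ℝ → ℝ} (hf : IsSubPDF f) :
    ∫ t in Ico (0 : ℝ) 1, f t ≤ 1 := by
  rw [integral_eq_lintegral_of_nonneg_ae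
    ((ae_restrict_iff' measurableSet_Ico).2 (ae_of_all _ hf.nonneg))
    hf.measurable.aestronglyMeasurable]
  exact ENNReal.toReal_le_of_le_ofReal zero_le_one (by simpa using hf.lintegral_le_one)

theorem IsSubPDF.integrableOn_mul {f g : ℝ → ℝ} (hf : IsSubPDF f) (hg : Measurable g) {C : ℝ}
    (hgC : ∀ t ∈ Ico (0 : ℝ) 1, |g t| ≤ C) : IntegrableOn (fun t => f t * g t) (Ico 0 1) :=
  Integrable.mul_bdd (c := C) hf.integrableOn hg.aestronglyMeasurable
    ((ae_restrict_iff' measurableSet_Ico).2 (ae_of_all _ hgC))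

/-- An exponential moment bound: the statistic `g` with mean at least `c + d` under `f` rarely has
an empirical mean below `c`. -/
theorem IsSubPDF.lintegral_exp_mul_le {f g : ℝ → ℝ} (hf : IsSubPDF f) (hg : Measurable g)
    (hg1 : ∀ t, |g t| ≤ 1) {l c d : ℝ} (hl0 : 0 ≤ l) (hl1 : l ≤ 1)
    (hcd : c + d ≤ ∫ t in Ico (0 : ℝ) 1, f t * g t) :
    ∫⁻ t in Ico (0 : ℝ) 1, ENNReal.ofReal (f t) * ENNReal.ofReal (Real.exp (-l * (g t - c))) ≤
      ENNReal.ofReal (Real.exp (l ^ 2 - l * d)) := by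
  have hfg := hf.integrableOn_mul hg fun t _ => hg1 t
  have hpt : ∀ t ∈ Ico (0 : ℝ) 1, f t * Real.exp (-l * (g t - c)) ≤
      Real.exp (l * c) * ((1 + l ^ 2) * f t - l * (f t * g t)) := by
    intro t ht
    have hx : |-(l * g t)| ≤ 1 := by
      rw [abs_neg, abs_mul, abs_of_nonneg hl0]
      exact mul_le_one₀ hl1 (abs_nonneg _) (hg1 t)
    have h1 := (abs_le.1 (Real.abs_exp_sub_one_sub_id_le hx)).2
    have h2 : (-(l * g t)) ^ 2 ≤ l ^ 2 := by
      rw [neg_sq, mul_pow]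
      exact mul_le_of_le_one_right (sq_nonneg l) ((sq_le_one_iff_abs_le_one _).2 (hg1 t))
    have h3 : Real.exp (-l * (g t - c)) = Real.exp (l * c) * Real.exp (-(l * g t)) := by
      rw [← Real.exp_add]; ring_nf
    rw [h3]
    calc f t * (Real.exp (l * c) * Real.exp (-(l * g t)))
        = Real.exp (l * c) * (f t * Real.exp (-(l * g t))) := by ring
      _ ≤ Real.exp (l * c) * (f t * (1 + l ^ 2 - l * g t)) :=
          mul_le_mul_of_nonneg_left
            (mul_le_mul_of_nonneg_left (by linarith) (hf.nonneg t ht)) (Real.exp_pos _).le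
      _ = _ := by ring
  have hint : IntegrableOn
      (fun t => Real.exp (l * c) * ((1 + l ^ 2) * f t - l * (f t * g t))) (Ico 0 1) :=
    ((hf.integrableOn.const_mul _).sub (hfg.const_mul _)).const_mul _
  calc ∫⁻ t in Ico (0 : ℝ) 1, ENNReal.ofReal (f t) * ENNReal.ofReal (Real.exp (-l * (g t - c)))
      ≤ ∫⁻ t in Ico (0 : ℝ) 1,
          ENNReal.ofReal (Real.exp (l * c) * ((1 + l ^ 2) * f t - l * (f t * g t))) := by
        refine setLIntegral_mono' measurableSet_Ico fun t ht => ?_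
        rw [← ENNReal.ofReal_mul (hf.nonneg t ht)]
        exact ENNReal.ofReal_le_ofReal (hpt t ht)
    _ = ENNReal.ofReal (∫ t in Ico (0 : ℝ) 1,
          Real.exp (l * c) * ((1 + l ^ 2) * f t - l * (f t * g t))) := by
        refine (ofReal_integral_eq_lintegral_ofReal hint ?_).symm
        refine (ae_restrict_iff' measurableSet_Ico).2 (ae_of_all _ fun t ht => ?_)
        exact (mul_nonneg (hf.nonneg t ht) (Real.exp_pos _).le).trans (hpt t ht)
    _ ≤ ENNReal.ofReal (Real.exp (l ^ 2 - l * d)) := by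
        refine ENNReal.ofReal_le_ofReal ?_
        rw [integral_const_mul, integral_sub (hf.integrableOn.const_mul _) (hfg.const_mul _),
          integral_const_mul, integral_const_mul]
        have h1 : (1 + l ^ 2) * ∫ t in Ico (0 : ℝ) 1, f t ≤ 1 + l ^ 2 :=
          mul_le_of_le_one_right (by positivity) hf.integral_le_one
        have h2 : l * (c + d) ≤ l * ∫ t in Ico (0 : ℝ) 1, f t * g t :=
          mul_le_mul_of_nonneg_left hcd hl0
        calc Real.exp (l * c) * ((1 + l ^ 2) * (∫ t in Ico (0 : ℝ) 1, f t) -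
              l * ∫ t in Ico (0 : ℝ) 1, f t * g t)
            ≤ Real.exp (l * c) * Real.exp (l ^ 2 - l * (c + d)) := by
              refine mul_le_mul_of_nonneg_left ?_ (Real.exp_pos _).le
              linarith [Real.add_one_le_exp (l ^ 2 - l * (c + d))]
          _ = Real.exp (l ^ 2 - l * d) := by
              rw [← Real.exp_add]; ring_nf

/-- The prior charges Kullback–Leibler neighbourhoods of `fstar`, in the following strong form: for
every `η > 0` there is a set `K` of positive prior mass on almost all of which the densities have a
common lower bound `h` on `[0,1)`, bounded away from zero and infinity, with `∫ f* log (f* / h) < η`. -/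
def KLSupported {Θ : Type*} [MeasurableSpace Θ] (prior : Measure Θ) (f : Θ → ℝ → ℝ)
    (fstar : ℝ → ℝ) : Prop :=
  ∀ η > 0, ∃ (K : Set Θ) (h : ℝ → ℝ) (b C : ℝ), MeasurableSet K ∧ 0 < prior K ∧ Measurable h ∧
    0 < b ∧ (∀ t ∈ Ico (0 : ℝ) 1, h t ∈ Icc b C) ∧
    (∀ᵐ θ ∂prior, θ ∈ K → ∀ t ∈ Ico (0 : ℝ) 1, h t ≤ f θ t) ∧
    (∫ t in Ico (0 : ℝ) 1, fstar t * Real.log (fstar t)) - η <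
      ∫ t in Ico (0 : ℝ) 1, fstar t * Real.log (h t)

theorem abs_log_le_of_mem_Icc {b C x : ℝ} (hb : 0 < b) (hx : x ∈ Icc b C) :
    |Real.log x| ≤ |Real.log b| + |Real.log C| := by
  have h1 : Real.log b ≤ Real.log x := Real.log_le_log hb hx.1
  have h2 : Real.log x ≤ Real.log C := Real.log_le_log (hb.trans_le hx.1) hx.2
  rw [abs_le]
  constructor
  · linarith [neg_abs_le (Real.log b), abs_nonneg (Real.log C)]
  · linarith [le_abs_self (Real.log C), abs_nonneg (Real.log b)]

section Consistency

variable {Ω Θ : Type*} [MeasurableSpace Ω] [MeasurableSpace Θ] {P : Measure Ω}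
  {fstar : ℝ → ℝ} {Z : ℕ → Ω → ℝ} {prior : Measure Θ}
  [IsProbabilityMeasure prior] {f : Θ → ℝ → ℝ}

/-- The integrated likelihood is not exponentially smaller than the likelihood of `fstar`. -/
theorem KLSupported.ae_eventually_le_lintegral_likelihood (hKL : KLSupported prior f fstar)
    (hfstar : IsPDF fstar) (hZ_meas : ∀ i, Measurable (Z i))
    (hZ_law : ∀ i, P.map (Z i) = pdfLaw fstar) (hZ_indep : iIndepFun Z P)
    (hent : IntegrableOn (fun t => fstar t * Real.log (fstar t)) (Ico 0 1))
    {η : ℝ} (hη : 0 < η) :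
    ∃ k : ENNReal, 0 < k ∧ k ≠ ⊤ ∧ ∀ᵐ ω ∂P, ∀ᶠ m : ℕ in atTop,
      k * (ENNReal.ofReal (Real.exp (-η)) ^ m * ∏ i : Fin m, ENNReal.ofReal (fstar (Z i ω))) ≤
        ∫⁻ θ, likelihood f (fun i : Fin m => Z i ω) θ ∂prior := by
  obtain ⟨K, h, b, C, hK, hK0, hh, hb, hhb, hhf, hlt⟩ := hKL η hη
  refine ⟨prior K, hK0, measure_ne_top _ _, ?_⟩
  have hinth : IntegrableOn (fun t => fstar t * Real.log (h t)) (Ico 0 1) :=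
    hfstar.isSubPDF.integrableOn_mul (Real.measurable_log.comp hh)
      fun t ht => abs_log_le_of_mem_Icc hb (hhb t ht)
  have hint : IntegrableOn (fun t => fstar t * (Real.log (h t) - Real.log (fstar t))) (Ico 0 1) := by
    simp only [mul_sub]
    exact hinth.sub hent
  have hlim := ae_tendsto_sum_sample_div hfstar hZ_meas hZ_law hZ_indep
    (φ := fun t => Real.log (h t) - Real.log (fstar t))
    ((Real.measurable_log.comp hh).sub (Real.measurable_log.comp hfstar.measurable)) hint
  have hneg : -η < ∫ t in Ico (0 : ℝ) 1, fstar t * (Real.log (h t) - Real.log (fstar t)) := by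
    simp only [mul_sub]
    rw [integral_sub hinth hent]
    linarith
  filter_upwards [hlim, ae_forall_sample_mem hfstar hZ_meas hZ_law] with ω hω hmem
  filter_upwards [hω.eventually (lt_mem_nhds hneg), eventually_gt_atTop 0] with m hm hm0
  have hm0' : (0 : ℝ) < m := Nat.cast_pos.2 hm0
  have hsum : -η * m < ∑ i : Fin m, (Real.log (h (Z i ω)) - Real.log (fstar (Z i ω))) :=
    (lt_div_iff₀ hm0').1 hm
  have hhpos : ∀ i, 0 < h (Z i ω) := fun i => hb.trans_le (hhb _ (hmem i).1).1
  have hprod : Real.exp (-η) ^ m * ∏ i : Fin m, fstar (Z i ω) ≤ ∏ i : Fin m, h (Z i ω) := by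
    rw [Finset.sum_sub_distrib] at hsum
    have e1 : ∏ i : Fin m, fstar (Z i ω) = Real.exp (∑ i : Fin m, Real.log (fstar (Z i ω))) := by
      rw [Real.exp_sum]
      exact Finset.prod_congr rfl fun i _ => (Real.exp_log (hmem i).2).symm
    have e2 : ∏ i : Fin m, h (Z i ω) = Real.exp (∑ i : Fin m, Real.log (h (Z i ω))) := by
      rw [Real.exp_sum]
      exact Finset.prod_congr rfl fun i _ => (Real.exp_log (hhpos i)).symm
    rw [e1, e2, ← Real.exp_nat_mul, ← Real.exp_add]
    exact Real.exp_le_exp.2 (by linarith)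
  calc prior K * (ENNReal.ofReal (Real.exp (-η)) ^ m *
        ∏ i : Fin m, ENNReal.ofReal (fstar (Z i ω)))
      ≤ prior K * ∏ i : Fin m, ENNReal.ofReal (h (Z i ω)) := by
        gcongr
        rw [← ENNReal.ofReal_pow (Real.exp_pos _).le,
          ← ENNReal.ofReal_prod_of_nonneg fun (i : Fin m) _ => (hmem i).2.le,
          ← ENNReal.ofReal_prod_of_nonneg fun (i : Fin m) _ => (hhpos i).le,
          ← ENNReal.ofReal_mul (pow_nonneg (Real.exp_pos _).le _)]
        exact ENNReal.ofReal_le_ofReal hprod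
    _ = ∫⁻ _ in K, ∏ i : Fin m, ENNReal.ofReal (h (Z i ω)) ∂prior := by
        rw [setLIntegral_const, mul_comm]
    _ ≤ ∫⁻ θ in K, likelihood f (fun i : Fin m => Z i ω) θ ∂prior := by
        refine lintegral_mono_ae ((ae_restrict_iff' hK).2 ?_)
        filter_upwards [hhf] with θ hθ hθK
        exact Finset.prod_le_prod' fun i _ =>
          ENNReal.ofReal_le_ofReal (hθ hθK _ (hmem i).1)
    _ ≤ ∫⁻ θ, likelihood f (fun i : Fin m => Z i ω) θ ∂prior := setLIntegral_le_lintegral _ _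

/-- If the mean of a bounded statistic `g` is at least `δ` larger under `f θ`, `θ ∈ U`, than under
`fstar`, then the likelihood integrated over `U` is exponentially smaller than the likelihood of
`fstar`. -/
theorem ae_eventually_setLIntegral_likelihood_le [IsProbabilityMeasure P]
    (hf : Measurable (Function.uncurry f))
    (hfstar : IsPDF fstar) (hZ_meas : ∀ i, Measurable (Z i))
    (hZ_law : ∀ i, P.map (Z i) = pdfLaw fstar) (hZ_indep : iIndepFun Z P)
    {g : ℝ → ℝ} (hg : Measurable g) (hg1 : ∀ t, |g t| ≤ 1) {δ : ℝ} (hδ : 0 < δ) {U : Set Θ}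
    (hU : ∀ᵐ θ ∂prior.restrict U, IsSubPDF (f θ) ∧
      (∫ t in Ico (0 : ℝ) 1, fstar t * g t) + δ ≤ ∫ t in Ico (0 : ℝ) 1, f θ t * g t) :
    ∃ κ > 0, ∀ᵐ ω ∂P, ∀ᶠ m : ℕ in atTop,
      ∫⁻ θ in U, likelihood f (fun i : Fin m => Z i ω) θ ∂prior ≤
        ENNReal.ofReal (Real.exp (-κ)) ^ m * ∏ i : Fin m, ENNReal.ofReal (fstar (Z i ω)) := by
  set c : ℝ := (∫ t in Ico (0 : ℝ) 1, fstar t * g t) + δ / 2 with hc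
  -- `l` is so small that the second-order term `l ^ 2` of the exponential moment is at most half of
  -- the first-order gain `l * (δ / 2)`.
  set l : ℝ := min 1 (δ / 4) with hl
  have hl0 : 0 < l := lt_min one_pos (by positivity)
  have hl1 : l ≤ 1 := min_le_left _ _
  have hl2 : l ^ 2 ≤ l * (δ / 4) := by
    rw [sq]
    exact mul_le_mul_of_nonneg_left (min_le_right _ _) hl0.le
  -- The exponential tilt `e` has mean less than one under `f θ`, `θ ∈ U`, while along the sample
  -- from `fstar` its product is eventually at least one.
  set e : ℝ → ENNReal := fun z => ENNReal.ofReal (Real.exp (-l * (g z - c))) with he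
  have hem : Measurable e :=
    (Real.measurable_exp.comp ((hg.sub_const c).const_mul (-l))).ennreal_ofReal
  set u : Θ → ℝ → ENNReal := fun θ z =>
    ENNReal.ofReal (f θ z) * e z / ENNReal.ofReal (fstar z) with hu
  have hum : Measurable (Function.uncurry u) :=
    (hf.ennreal_ofReal.mul (hem.comp measurable_snd)).div
      (hfstar.measurable.ennreal_ofReal.comp measurable_snd)
  have hκ : 0 < l * (δ / 4) / 2 := by positivity
  have hρr : Real.toNNReal (Real.exp (-(l * (δ / 4)))) <
      Real.toNNReal (Real.exp (-(l * (δ / 4) / 2))) := by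
    rw [Real.toNNReal_lt_toNNReal_iff (Real.exp_pos _)]
    exact Real.exp_lt_exp.2 (by linarith)
  have hρ : ∀ᵐ θ ∂prior.restrict U, ∫⁻ z, u θ z ∂pdfLaw fstar ≤
      (Real.toNNReal (Real.exp (-(l * (δ / 4)))) : ENNReal) := by
    filter_upwards [hU] with θ hθ
    rw [lintegral_pdfLaw hfstar.measurable hum.of_uncurry_left]
    calc ∫⁻ z in Ico (0 : ℝ) 1, ENNReal.ofReal (fstar z) * u θ z
        ≤ ∫⁻ z in Ico (0 : ℝ) 1, ENNReal.ofReal (f θ z) * e z :=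
          lintegral_mono fun z => ENNReal.mul_div_le
      _ ≤ ENNReal.ofReal (Real.exp (l ^ 2 - l * (δ / 2))) :=
          hθ.1.lintegral_exp_mul_le hg hg1 hl0.le hl1 (by linarith [hθ.2])
      _ ≤ ENNReal.ofReal (Real.exp (-(l * (δ / 4)))) :=
          ENNReal.ofReal_le_ofReal (Real.exp_le_exp.2 (by linarith))
  have hν : prior.restrict U univ ≤ 1 := by
    rw [Measure.restrict_apply_univ]
    exact prob_le_one
  have hdecay := ae_eventually_lintegral_prod_le hZ_meas hZ_law hZ_indep hν hum hρr hρ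
  have hlim := ae_tendsto_sum_sample_div hfstar hZ_meas hZ_law hZ_indep hg
    (hfstar.isSubPDF.integrableOn_mul hg fun t _ => hg1 t)
  refine ⟨_, hκ, ?_⟩
  filter_upwards [hdecay, hlim, ae_forall_sample_mem hfstar hZ_meas hZ_law] with ω h1 h2 hmem
  have hlt : ∫ t in Ico (0 : ℝ) 1, fstar t * g t < c := by linarith
  filter_upwards [h1, h2.eventually (gt_mem_nhds hlt), eventually_gt_atTop 0] with m hm1 hm2 hm0
  have hm0' : (0 : ℝ) < m := Nat.cast_pos.2 hm0
  have hsum : ∑ i : Fin m, g (Z i ω) < c * m := (div_lt_iff₀ hm0').1 hm2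
  have heprod : 1 ≤ ∏ i : Fin m, e (Z i ω) := by
    rw [he, ← ENNReal.ofReal_prod_of_nonneg fun i _ => (Real.exp_pos _).le, ← Real.exp_sum,
      ENNReal.one_le_ofReal, Real.one_le_exp_iff, ← Finset.mul_sum, Finset.sum_sub_distrib]
    simp only [Finset.sum_const, Finset.card_univ, Fintype.card_fin, nsmul_eq_mul]
    nlinarith
  have hpt : ∀ θ, likelihood f (fun i : Fin m => Z i ω) θ ≤
      (∏ i : Fin m, u θ (Z i ω)) * ∏ i : Fin m, ENNReal.ofReal (fstar (Z i ω)) := by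
    intro θ
    rw [← Finset.prod_mul_distrib]
    have : ∀ i : Fin m, u θ (Z i ω) * ENNReal.ofReal (fstar (Z i ω)) =
        ENNReal.ofReal (f θ (Z i ω)) * e (Z i ω) := fun i =>
      ENNReal.div_mul_cancel (by simpa using (hmem i).2) ENNReal.ofReal_ne_top
    rw [Finset.prod_congr rfl fun i _ => this i, Finset.prod_mul_distrib]
    exact le_mul_of_one_le_right' heprod
  calc ∫⁻ θ in U, likelihood f (fun i : Fin m => Z i ω) θ ∂prior
      ≤ ∫⁻ θ in U, (∏ i : Fin m, u θ (Z i ω)) *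
          ∏ i : Fin m, ENNReal.ofReal (fstar (Z i ω)) ∂prior := lintegral_mono hpt
    _ = (∫⁻ θ in U, (∏ i : Fin m, u θ (Z i ω)) ∂prior) *
          ∏ i : Fin m, ENNReal.ofReal (fstar (Z i ω)) :=
        lintegral_mul_const' _ _ (ENNReal.prod_ne_top fun i _ => ENNReal.ofReal_ne_top)
    _ ≤ _ := by gcongr; exact hm1

/-- The posterior mass of a set of parameters vanishes if a bounded statistic separates it from
`fstar`. -/
theorem KLSupported.ae_tendsto_posterior_zero [IsProbabilityMeasure P]
    (hKL : KLSupported prior f fstar)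
    (hf : Measurable (Function.uncurry f))
    (hfstar : IsPDF fstar) (hZ_meas : ∀ i, Measurable (Z i))
    (hZ_law : ∀ i, P.map (Z i) = pdfLaw fstar) (hZ_indep : iIndepFun Z P)
    (hent : IntegrableOn (fun t => fstar t * Real.log (fstar t)) (Ico 0 1))
    {Q : (m : ℕ) → Kernel (Fin m → ℝ) Θ} (hQ : ∀ m, IsPosterior prior f m (Q m))
    {g : ℝ → ℝ} (hg : Measurable g) (hg1 : ∀ t, |g t| ≤ 1) {δ : ℝ} (hδ : 0 < δ) {U : Set Θ}
    (hUm : MeasurableSet U)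
    (hU : ∀ᵐ θ ∂prior.restrict U, IsSubPDF (f θ) ∧
      (∫ t in Ico (0 : ℝ) 1, fstar t * g t) + δ ≤ ∫ t in Ico (0 : ℝ) 1, f θ t * g t) :
    ∀ᵐ ω ∂P, Tendsto (fun m : ℕ => Q m (fun i : Fin m => Z i ω) U) atTop (𝓝 0) := by
  obtain ⟨κ, hκ, hnum⟩ :=
    ae_eventually_setLIntegral_likelihood_le hf hfstar hZ_meas hZ_law hZ_indep hg hg1 hδ hU
  obtain ⟨k, hk, hk', hden⟩ := hKL.ae_eventually_le_lintegral_likelihood hfstar hZ_meas hZ_law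
    hZ_indep hent (half_pos hκ)
  have hbayes : ∀ᵐ ω ∂P, ∀ m : ℕ,
      Q m (fun i : Fin m => Z i ω) U *
        ∫⁻ θ, likelihood f (fun i : Fin m => Z i ω) θ ∂prior =
      ∫⁻ θ in U, likelihood f (fun i : Fin m => Z i ω) θ ∂prior := by
    refine ae_all_iff.2 fun m => ?_
    exact ae_of_ae_map (measurable_pi_lambda _ fun i : Fin m => hZ_meas i).aemeasurable
      ((map_sample_absolutelyContinuous hfstar hZ_meas hZ_law hZ_indep m).ae_le
        ((hQ m).mul_lintegral_likelihood hf hUm))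
  set q : ENNReal := ENNReal.ofReal (Real.exp (-(κ / 2))) with hq
  have hq1 : q < 1 := by
    rw [hq, ENNReal.ofReal_lt_one, Real.exp_lt_one_iff]
    linarith
  have hq0 : q ≠ 0 := by simpa [hq] using Real.exp_pos _
  have hqq : ENNReal.ofReal (Real.exp (-κ)) = q * q := by
    rw [hq, ← ENNReal.ofReal_mul (Real.exp_pos _).le, ← Real.exp_add]
    ring_nf
  have hlim : Tendsto (fun m : ℕ => q ^ m / k) atTop (𝓝 0) := by
    have := ENNReal.Tendsto.div_const (ENNReal.tendsto_pow_atTop_nhds_zero_of_lt_one hq1)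
      (b := k) (Or.inr hk.ne')
    simpa using this
  filter_upwards [hnum, hden, hbayes, ae_forall_sample_mem hfstar hZ_meas hZ_law]
    with ω h1 h2 h3 hmem
  refine tendsto_of_tendsto_of_tendsto_of_le_of_le' tendsto_const_nhds hlim
    (Eventually.of_forall fun _ => zero_le) ?_
  filter_upwards [h1, h2] with m hm1 hm2
  set F : ENNReal := ∏ i : Fin m, ENNReal.ofReal (fstar (Z i ω)) with hF
  have hF0 : F ≠ 0 := Finset.prod_ne_zero_iff.2 fun i _ => by simpa using (hmem i).2
  have hFt : F ≠ ⊤ := ENNReal.prod_ne_top fun i _ => ENNReal.ofReal_ne_top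
  have hqF0 : q ^ m * F ≠ 0 := mul_ne_zero (pow_ne_zero _ hq0) hF0
  have hqFt : q ^ m * F ≠ ⊤ := ENNReal.mul_ne_top (ENNReal.pow_ne_top ENNReal.ofReal_ne_top) hFt
  have key : Q m (fun i : Fin m => Z i ω) U * k * (q ^ m * F) ≤ q ^ m * (q ^ m * F) := by
    calc Q m (fun i : Fin m => Z i ω) U * k * (q ^ m * F)
        = Q m (fun i : Fin m => Z i ω) U * (k * (q ^ m * F)) := mul_assoc _ _ _
      _ ≤ Q m (fun i : Fin m => Z i ω) U *
            ∫⁻ θ, likelihood f (fun i : Fin m => Z i ω) θ ∂prior := by gcongr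
      _ ≤ _ := (h3 m).trans_le hm1
      _ = q ^ m * (q ^ m * F) := by rw [hqq, mul_pow, mul_assoc]
  rw [ENNReal.le_div_iff_mul_le (Or.inl hk.ne') (Or.inl hk')]
  exact (ENNReal.mul_le_mul_iff_left hqF0 hqFt).1 key

end Consistency

/-! ### Kolmogorov–Smirnov neighbourhoods -/

theorem integral_mul_indicator_Iio (f : ℝ → ℝ) {x : ℝ} (hx : x ∈ Icc (0 : ℝ) 1) :
    ∫ t in Ico (0 : ℝ) 1, f t * (Iio x).indicator 1 t = ∫ t in (0 : ℝ)..x, f t := by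
  have h1 : ∀ t, f t * (Iio x).indicator 1 t = (Iio x).indicator f t := fun t => by
    by_cases h : t ∈ Iio x <;> simp [h]
  simp only [h1]
  rw [setIntegral_indicator measurableSet_Iio, Ico_inter_Iio, min_eq_right hx.2,
    intervalIntegral.integral_of_le hx.1, integral_Ico_eq_integral_Ioo,
    integral_Ioc_eq_integral_Ioo]

theorem IsSubPDF.intervalIntegrable {f : ℝ → ℝ} (hf : IsSubPDF f) {x y : ℝ}
    (hx : x ∈ Icc (0 : ℝ) 1) (hy : y ∈ Icc (0 : ℝ) 1) : IntervalIntegrable f volume x y := by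
  refine IntegrableOn.intervalIntegrable ?_
  exact ((integrableOn_Icc_iff_integrableOn_Ico).2 hf.integrableOn).mono_set
    (uIcc_subset_Icc hx hy)

theorem IsSubPDF.integral_mono {f : ℝ → ℝ} (hf : IsSubPDF f) {x y : ℝ}
    (hx : x ∈ Icc (0 : ℝ) 1) (hy : y ∈ Icc (0 : ℝ) 1) (hxy : x ≤ y) :
    ∫ t in (0 : ℝ)..x, f t ≤ ∫ t in (0 : ℝ)..y, f t := by
  have h0 : (0 : ℝ) ∈ Icc (0 : ℝ) 1 := by simp
  rw [← intervalIntegral.integral_add_adjacent_intervals (hf.intervalIntegrable h0 hx)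
    (hf.intervalIntegrable hx hy)]
  have : 0 ≤ ∫ t in x..y, f t := by
    rw [intervalIntegral.integral_of_le hxy, integral_Ioc_eq_integral_Ioo]
    exact setIntegral_nonneg measurableSet_Ioo fun t ht =>
      hf.nonneg t ⟨hx.1.trans ht.1.le, ht.2.trans_le hy.2⟩
  linarith

theorem IsSubPDF.continuousOn_integral {f : ℝ → ℝ} (hf : IsSubPDF f) :
    ContinuousOn (fun x => ∫ t in (0 : ℝ)..x, f t) (Icc 0 1) := by
  have h := intervalIntegral.continuousOn_primitive_interval (μ := volume) (f := f) (a := 0)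
    (b := 1) (by
      rw [uIcc_of_le zero_le_one]
      exact (integrableOn_Icc_iff_integrableOn_Ico).2 hf.integrableOn)
  rwa [uIcc_of_le zero_le_one] at h

/-- As `fstar` has a continuous distribution function, a Kolmogorov–Smirnov ball around it contains
a neighbourhood given by the values of the distribution function on a finite grid. -/
theorem IsPDF.exists_finset_dKS_lt {fstar : ℝ → ℝ} (hfstar : IsPDF fstar) {ε : ℝ} (hε : 0 < ε) :
    ∃ S : Finset ℝ, (∀ x ∈ S, x ∈ Icc (0 : ℝ) 1) ∧ ∃ δ > 0, ∀ f₁, IsSubPDF f₁ →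
      (∀ x ∈ S, |(∫ t in (0 : ℝ)..x, f₁ t) - ∫ t in (0 : ℝ)..x, fstar t| < δ) →
        dKS f₁ fstar < ε := by
  have huc := Metric.uniformContinuousOn_iff.1
    (isCompact_Icc.uniformContinuousOn_of_continuous hfstar.isSubPDF.continuousOn_integral)
    (ε / 3) (by positivity)
  obtain ⟨δ₀, hδ₀, huc⟩ := huc
  obtain ⟨n, hn⟩ := exists_nat_one_div_lt hδ₀
  set M : ℝ := (n : ℝ) + 1 with hM
  have hM0 : 0 < M := by positivity
  refine ⟨(Finset.range (n + 2)).image fun j : ℕ => (j : ℝ) / M, ?_, ε / 3, by positivity, ?_⟩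
  · intro x hx
    obtain ⟨j, hj, rfl⟩ := Finset.mem_image.1 hx
    refine ⟨by positivity, (div_le_one hM0).2 ?_⟩
    have : j ≤ n + 1 := Nat.lt_succ_iff.1 (Finset.mem_range.1 hj)
    rw [hM]
    exact_mod_cast this
  intro f₁ hf₁ hS
  refine lt_of_le_of_lt (csSup_le ((nonempty_Ico.2 zero_lt_one).image _) ?_)
    (show 2 * ε / 3 < ε by linarith)
  rintro _ ⟨x, hx, rfl⟩
  set j : ℕ := ⌊x * M⌋₊ with hj
  have hxM : 0 ≤ x * M := mul_nonneg hx.1 hM0.le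
  have hj1 : (j : ℝ) ≤ x * M := Nat.floor_le hxM
  have hj2 : x * M < j + 1 := Nat.lt_floor_add_one _
  have hjn : j ≤ n := by
    have : (j : ℝ) < ((n + 1 : ℕ) : ℝ) := by
      push_cast
      have := mul_lt_mul_of_pos_right hx.2 hM0
      linarith
    exact Nat.lt_succ_iff.1 (by exact_mod_cast this)
  have hjn' : (j : ℝ) ≤ n := by exact_mod_cast hjn
  have a1 : (j : ℝ) / M ≤ x := (div_le_iff₀ hM0).2 hj1
  have a2 : x ≤ ((j + 1 : ℕ) : ℝ) / M := (le_div_iff₀ hM0).2 (by push_cast; exact hj2.le)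
  have a3 : ((j + 1 : ℕ) : ℝ) / M = (j : ℝ) / M + 1 / M := by push_cast; ring
  have hxI : x ∈ Icc (0 : ℝ) 1 := ⟨hx.1, hx.2.le⟩
  have m1 : (j : ℝ) / M ∈ Icc (0 : ℝ) 1 := ⟨by positivity, a1.trans hx.2.le⟩
  have m2 : ((j + 1 : ℕ) : ℝ) / M ∈ Icc (0 : ℝ) 1 :=
    ⟨by positivity, (div_le_one hM0).2 (by push_cast; linarith)⟩
  have s1 := abs_lt.1 (hS _ (Finset.mem_image_of_mem _ (Finset.mem_range.2 (by omega : j < n + 2))))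
  have s2 := abs_lt.1
    (hS _ (Finset.mem_image_of_mem _ (Finset.mem_range.2 (by omega : j + 1 < n + 2))))
  have c1 := abs_lt.1 (huc _ m1 x hxI (by
    rw [Real.dist_eq, abs_lt]; constructor <;> linarith))
  have c2 := abs_lt.1 (huc _ m2 x hxI (by
    rw [Real.dist_eq, abs_lt]; constructor <;> linarith))
  have d1 := hf₁.integral_mono m1 hxI a1
  have d2 := hf₁.integral_mono hxI m2 a2
  rw [abs_le]
  constructor <;> linarith [s1.1, s1.2, s2.1, s2.2, c1.1, c1.2, c2.1, c2.2]

/-- **Schwartz's theorem** for the Kolmogorov–Smirnov distance: a prior on densities that charges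
the Kullback–Leibler neighbourhoods of `fstar` is consistent at `fstar`. -/
theorem KLSupported.ksConsistent {Ω Θ : Type*} [MeasurableSpace Ω] [MeasurableSpace Θ]
    {P : Measure Ω} [IsProbabilityMeasure P] {fstar : ℝ → ℝ} {Z : ℕ → Ω → ℝ} {prior : Measure Θ}
    [IsProbabilityMeasure prior] {f : Θ → ℝ → ℝ} (hKL : KLSupported prior f fstar)
    (hf : Measurable (Function.uncurry f)) (hsub : ∀ᵐ θ ∂prior, IsSubPDF (f θ))
    (hfstar : IsPDF fstar) (hZ_meas : ∀ i, Measurable (Z i))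
    (hZ_law : ∀ i, P.map (Z i) = pdfLaw fstar) (hZ_indep : iIndepFun Z P)
    (hent : IntegrableOn (fun t => fstar t * Real.log (fstar t)) (Ico 0 1))
    {ε : ℝ} (hε : 0 < ε) : KSConsistent P Z fstar prior f ε := by
  intro Q hQ
  obtain ⟨S, hS01, δ, hδ, hS⟩ := hfstar.exists_finset_dKS_lt hε
  obtain ⟨T, hsubT, hTm, hT0⟩ := exists_measurable_superset_of_null hsub
  set g : ℝ → Bool → ℝ → ℝ := fun x σ => if σ then (Iio x).indicator 1 else -(Iio x).indicator 1
    with hg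
  have hgm : ∀ x σ, Measurable (g x σ) := by
    intro x σ
    have : Measurable ((Iio x).indicator (1 : ℝ → ℝ)) :=
      measurable_one.indicator measurableSet_Iio
    cases σ
    · simpa [hg] using this.neg
    · simpa [hg] using this
  have hg1 : ∀ x σ t, |g x σ t| ≤ 1 := by
    intro x σ t
    have h : |(Iio x).indicator (1 : ℝ → ℝ) t| ≤ 1 := by
      by_cases h : t ∈ Iio x
      · simp [indicator_of_mem h]
      · simp [indicator_of_notMem h]
    cases σ
    · simpa [hg] using h
    · simpa [hg] using h
  set U : ℝ → Bool → Set Θ := fun x σ =>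
    {θ | (∫ t in Ico (0 : ℝ) 1, fstar t * g x σ t) + δ ≤ ∫ t in Ico (0 : ℝ) 1, f θ t * g x σ t}
    with hU
  have hUm : ∀ x σ, MeasurableSet (U x σ) := by
    intro x σ
    refine measurableSet_le measurable_const (StronglyMeasurable.measurable ?_)
    exact StronglyMeasurable.integral_prod_right (f := fun θ t => f θ t * g x σ t)
      (hf.mul ((hgm x σ).comp measurable_snd)).stronglyMeasurable
  have hUlim : ∀ᵐ ω ∂P, ∀ x ∈ S, ∀ σ : Bool,
      Tendsto (fun m : ℕ => Q m (fun i : Fin m => Z i ω) (U x σ)) atTop (𝓝 0) := by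
    refine (ae_ball_iff S.countable_toSet).2 fun x _ => ae_all_iff.2 fun σ => ?_
    refine hKL.ae_tendsto_posterior_zero hf hfstar hZ_meas hZ_law hZ_indep hent hQ (hgm x σ)
      (hg1 x σ) hδ (hUm x σ) ?_
    filter_upwards [ae_restrict_mem (hUm x σ), ae_restrict_of_ae hsub] with θ h1 h2
    exact ⟨h2, h1⟩
  have hTlim : ∀ᵐ ω ∂P, Tendsto (fun m : ℕ => Q m (fun i : Fin m => Z i ω) T) atTop (𝓝 0) := by
    refine hKL.ae_tendsto_posterior_zero hf hfstar hZ_meas hZ_law hZ_indep hent hQ (hgm 0 true)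
      (hg1 0 true) hδ hTm ?_
    rw [Measure.restrict_eq_zero.2 hT0]
    exact ae_zero.symm ▸ eventually_bot
  filter_upwards [hUlim, hTlim] with ω h1 h2
  set B : Set Θ := T ∪ ⋃ x ∈ S, ⋃ σ ∈ (Finset.univ : Finset Bool), U x σ with hB
  have hBm : MeasurableSet B := hTm.union
    (Finset.measurableSet_biUnion _ fun x _ => Finset.measurableSet_biUnion _ fun σ _ => hUm x σ)
  have hBlim : Tendsto (fun m : ℕ => Q m (fun i : Fin m => Z i ω) B) atTop (𝓝 0) := by
    have hsum : Tendsto (fun m : ℕ => Q m (fun i : Fin m => Z i ω) T +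
        ∑ x ∈ S, ∑ σ : Bool, Q m (fun i : Fin m => Z i ω) (U x σ)) atTop (𝓝 0) := by
      have := h2.add (tendsto_finsetSum S fun x hx =>
        tendsto_finsetSum (Finset.univ : Finset Bool) fun σ _ => h1 x hx σ)
      simpa using this
    refine tendsto_of_tendsto_of_tendsto_of_le_of_le tendsto_const_nhds hsum
      (fun _ => zero_le) fun m => ?_
    refine (measure_union_le _ _).trans (add_le_add le_rfl ?_)
    refine (measure_biUnion_finset_le _ _).trans (Finset.sum_le_sum fun x _ => ?_)
    exact measure_biUnion_finset_le _ _
  have hcompl : Bᶜ ⊆ {θ | dKS (f θ) fstar < ε} := by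
    intro θ hθ
    have hθT : IsSubPDF (f θ) := by
      by_contra h
      exact hθ (Or.inl (hsubT h))
    refine hS _ hθT fun x hx => ?_
    have hnot : ∀ σ, θ ∉ U x σ := fun σ h =>
      hθ (Or.inr (mem_biUnion hx (mem_biUnion (Finset.mem_univ σ) h)))
    have e1 := integral_mul_indicator_Iio fstar (hS01 x hx)
    have e2 := integral_mul_indicator_Iio (f θ) (hS01 x hx)
    have n1 := hnot true
    have n2 := hnot false
    simp only [hU, hg, mem_ofPred_eq, not_le, if_true, Bool.false_eq_true, if_false, Pi.neg_apply,
      mul_neg, integral_neg, e1, e2] at n1 n2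
    rw [abs_lt]
    constructor <;> linarith
  have hlow : Tendsto (fun m : ℕ => 1 - Q m (fun i : Fin m => Z i ω) B) atTop (𝓝 1) := by
    have := ENNReal.Tendsto.sub (tendsto_const_nhds (x := (1 : ENNReal)) (f := atTop)) hBlim
      (Or.inl ENNReal.one_ne_top)
    simpa using this
  refine tendsto_of_tendsto_of_tendsto_of_le_of_le hlow tendsto_const_nhds (fun m => ?_)
    fun m => ?_
  · have := (hQ m).1
    rw [← prob_compl_eq_one_sub hBm]
    exact measure_mono hcompl
  · have := (hQ m).1
    exact prob_le_one

/-! ### The support of beta-distributed sequences -/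

theorem measurable_betaPDF (a b : ℝ) : Measurable (betaPDF a b) :=
  (measurable_betaPDFReal a b).ennreal_ofReal

theorem betaMeasure_pos_of_isOpen {a b : ℝ} (ha : 0 < a) (hb : 0 < b) {O : Set ℝ} (hO : IsOpen O)
    {x : ℝ} (hx : x ∈ O) (hx01 : x ∈ Ioo (0 : ℝ) 1) : 0 < betaMeasure a b O := by
  rw [pos_iff_ne_zero, betaMeasure, ne_eq, withDensity_apply_eq_zero (measurable_betaPDF a b)]
  have hsub : Ioo (0 : ℝ) 1 ∩ O ⊆ {x | betaPDF a b x ≠ 0} ∩ O := by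
    rintro z ⟨hz, hzO⟩
    refine ⟨?_, hzO⟩
    simpa [betaPDF] using betaPDFReal_pos hz.1 hz.2 ha hb
  have hpos : 0 < (volume : Measure ℝ) (Ioo (0 : ℝ) 1 ∩ O) :=
    (isOpen_Ioo.inter hO).measure_pos volume ⟨x, hx01, hx⟩
  exact (hpos.trans_le (measure_mono hsub)).ne'

theorem ae_betaMeasure_mem_Ioo (a b : ℝ) : ∀ᵐ x ∂betaMeasure a b, x ∈ Ioo (0 : ℝ) 1 := by
  rw [betaMeasure, ae_withDensity_iff (measurable_betaPDF a b)]
  refine ae_of_all _ fun x hx => ?_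
  by_contra h
  rcases not_and_or.1 h with h | h
  · exact hx (betaPDF_eq_zero_of_nonpos (not_lt.1 h))
  · exact hx (betaPDF_eq_zero_of_one_le (not_lt.1 h))

instance (α : Word → ℝ) : IsProbabilityMeasure (betaSeqLaw α) := by
  unfold betaSeqLaw
  infer_instance

theorem betaLaw_eq_betaMeasure {α : Word → ℝ} (hα : ∀ s : Word, s ≠ [] → 0 < α s)
    (s : Word) :
    betaLaw (α (s ++ [false])) (α (s ++ [true])) =
      betaMeasure (α (s ++ [false])) (α (s ++ [true])) :=
  if_pos ⟨hα _ (by simp), hα _ (by simp)⟩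

/-- A beta-distributed sequence with positive parameters has full support. -/
theorem betaSeqLaw_pos_of_isOpen {α : Word → ℝ} (hα : ∀ s : Word, s ≠ [] → 0 < α s)
    {V : Set BetaSeq} (hV : IsOpen V) {y : BetaSeq} (hy : y ∈ V)
    (hy01 : ∀ s, y s ∈ Ioo (0 : ℝ) 1) : 0 < betaSeqLaw α V := by
  obtain ⟨S, u, hu, hsub⟩ := isOpen_pi_iff.1 hV y hy
  refine lt_of_lt_of_le ?_ (measure_mono hsub)
  rw [betaSeqLaw, Measure.infinitePi_pi _ fun s hs => (hu s hs).1.measurableSet]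
  refine pos_iff_ne_zero.2 (Finset.prod_ne_zero_iff.2 fun s hs => ?_)
  rw [betaLaw_eq_betaMeasure hα]
  exact (betaMeasure_pos_of_isOpen (hα _ (by simp)) (hα _ (by simp)) (hu s hs).1 (hu s hs).2
    (hy01 s)).ne'

theorem ae_betaSeqLaw_mem_Ioo {α : Word → ℝ} (hα : ∀ s : Word, s ≠ [] → 0 < α s) :
    ∀ᵐ y ∂betaSeqLaw α, ∀ s, y s ∈ Ioo (0 : ℝ) 1 := by
  refine ae_all_iff.2 fun s => ?_
  have h := measurePreserving_eval_infinitePi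
    (fun s : Word => betaLaw (α (s ++ [false])) (α (s ++ [true]))) s
  refine h.quasiMeasurePreserving.ae (p := fun x => x ∈ Ioo (0 : ℝ) 1) ?_
  rw [betaLaw_eq_betaMeasure hα]
  exact ae_betaMeasure_mem_Ioo _ _

/-! ### Approximation of densities by step functions in Kullback–Leibler divergence -/

namespace NBP

/-- Any assignment of masses to the intervals by increments of a strictly increasing distribution
function comes from branch weights in `(0, 1)`. -/
theorem exists_pathProd_eq (I : NBP) {G : ℝ → ℝ} (hG : StrictMonoOn G (Icc 0 1))
    (hG0 : G 0 = 0) (hG1 : G 1 = 1) :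
    ∃ y : BetaSeq, (∀ s, y s ∈ Ioo (0 : ℝ) 1) ∧
      ∀ s, pathProd y s = G (I.a s + I.len s) - G (I.a s) := by
  set μ : Word → ℝ := fun s => G (I.a s + I.len s) - G (I.a s) with hμ
  have hμpos : ∀ s, 0 < μ s := fun s => by
    have h := I.a_nonneg_and_a_add_len_le_one s
    have hl := I.len_pos s
    exact sub_pos.2 (hG ⟨h.1, by linarith⟩ ⟨by linarith, h.2⟩ (by linarith))
  have hadd : ∀ s, μ s = μ (s ++ [false]) + μ (s ++ [true]) := fun s => by
    have e : I.a s + I.len (s ++ [false]) + I.len (s ++ [true]) = I.a s + I.len s := by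
      rw [I.len_split s, add_assoc]
    simp only [hμ, I.a_one, I.a_zero, e]
    ring
  refine ⟨fun s => μ (s ++ [false]) / μ s, fun s => ⟨div_pos (hμpos _) (hμpos _), ?_⟩, fun s => ?_⟩
  · rw [div_lt_one (hμpos s)]
    linarith [hadd s, hμpos (s ++ [true])]
  · change _ = μ s
    induction s using List.reverseRecOn with
    | nil => simp [pathProd_nil, hμ, I.a_nil, I.len_nil, hG0, hG1]
    | append_singleton s k ih =>
      have h := (hμpos s).ne'
      rw [pathProd_append_singleton, ih]
      cases k
      · simp only [branch, Bool.false_eq_true, if_false]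
        field_simp
      · simp only [branch, if_true]
        field_simp
        linarith [hadd s]

/-- Lebesgue differentiation along a shrinking partition. -/
theorem Shrinking.ae_tendsto_average {I : NBP} (hI : I.Shrinking) {f : ℝ → ℝ}
    (hf : IntegrableOn f (Ico 0 1)) :
    ∀ᵐ t ∂volume.restrict (Ico (0 : ℝ) 1), Tendsto (fun n =>
      (∫ u in I.a (I.locate t n)..I.a (I.locate t n) + I.len (I.locate t n), f u) /
        I.len (I.locate t n)) atTop (𝓝 (f t)) := by
  have hF : LocallyIntegrable ((Ico (0 : ℝ) 1).indicator f) volume :=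
    ((integrable_indicator_iff measurableSet_Ico).2 hf).locallyIntegrable
  filter_upwards [ae_restrict_of_ae (IsUnifLocDoublingMeasure.ae_tendsto_average volume hF 1),
    ae_restrict_mem measurableSet_Ico] with t h ht
  set w : ℕ → Word := fun n => I.locate t n with hw
  have hlen : Tendsto (fun n => I.len (w n)) atTop (𝓝 0) := hI.tendsto_len_locate ht
  have hhalf : Tendsto (fun n => I.len (w n) / 2) atTop (𝓝[>] 0) :=
    tendsto_nhdsWithin_iff.2 ⟨by simpa using hlen.div_const 2,
      Eventually.of_forall fun n => half_pos (I.len_pos _)⟩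
  have hball : ∀ᶠ n in atTop, t ∈ Metric.closedBall (I.a (w n) + I.len (w n) / 2)
      (1 * (I.len (w n) / 2)) := Eventually.of_forall fun n => by
    have := I.mem_locate ht n
    rw [one_mul, Real.closedBall_eq_Icc]
    constructor <;> linarith [this.1, this.2]
  have hlim := h (l := atTop) (fun n => I.a (w n) + I.len (w n) / 2) (fun n => I.len (w n) / 2)
    hhalf
    hball
  rw [indicator_of_mem ht] at hlim
  refine hlim.congr fun n => ?_
  have hbd := I.a_nonneg_and_a_add_len_le_one (w n)
  have hl := I.len_pos (w n)
  rw [Real.closedBall_eq_Icc, setAverage_eq, Real.volume_real_Icc_of_le (by linarith), smul_eq_mul]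
  have e1 : I.a (w n) + I.len (w n) / 2 - I.len (w n) / 2 = I.a (w n) := by ring
  have e2 : I.a (w n) + I.len (w n) / 2 + I.len (w n) / 2 = I.a (w n) + I.len (w n) := by ring
  rw [e1, e2, add_sub_cancel_left, integral_Icc_eq_integral_Ico,
    intervalIntegral.integral_of_le (by linarith), integral_Ioc_eq_integral_Ioo,
    ← integral_Ico_eq_integral_Ioo, div_eq_inv_mul]
  congr 1
  refine setIntegral_congr_fun measurableSet_Ico fun u hu => ?_
  exact indicator_of_mem (mem_Ico.2 ⟨hbd.1.trans hu.1, hu.2.trans_le hbd.2⟩) f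

/-- A density of finite entropy is approximated in Kullback–Leibler divergence by positive step
densities on the levels of a shrinking partition. The step density is the level-`n` average of the
mixture of `fstar` with a small uniform component. This component bounds the logarithms from below,
so that Fatou's lemma applies to the differentiation theorem. -/
theorem Shrinking.exists_lt_integral_mul_log_stepDensity {I : NBP} (hI : I.Shrinking)
    {fstar : ℝ → ℝ} (hfstar : IsPDF fstar)
    (hent : IntegrableOn (fun t => fstar t * Real.log (fstar t)) (Ico 0 1)) {η : ℝ} (hη : 0 < η) :
    ∃ (n : ℕ) (y : BetaSeq), (∀ s, y s ∈ Ioo (0 : ℝ) 1) ∧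
      (∫ t in Ico (0 : ℝ) 1, fstar t * Real.log (fstar t)) - η <
        ∫ t in Ico (0 : ℝ) 1, fstar t * Real.log (stepDensity I.a I.len n y t) := by
  set q : ℝ := Real.exp (-(η / 2)) with hq
  have hq0 : 0 < q := Real.exp_pos _
  have hq1 : q < 1 := Real.exp_lt_one_iff.2 (by linarith)
  set γ : ℝ := 1 - q with hγ
  have hγ0 : 0 < γ := sub_pos.2 hq1
  have hsub := hfstar.isSubPDF
  set G : ℝ → ℝ := fun x => q * (∫ t in (0 : ℝ)..x, fstar t) + γ * x with hG
  have hGmono : StrictMonoOn G (Icc 0 1) := fun x hx z hz hxz =>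
    add_lt_add_of_le_of_lt (mul_le_mul_of_nonneg_left (hsub.integral_mono hx hz hxz.le) hq0.le)
      (mul_lt_mul_of_pos_left hxz hγ0)
  have hG0 : G 0 = 0 := by simp [hG]
  have hG1 : G 1 = 1 := by
    have : ∫ t in (0 : ℝ)..1, fstar t = 1 := by
      rw [intervalIntegral.integral_of_le zero_le_one, integral_Ioc_eq_integral_Ioo,
        ← integral_Ico_eq_integral_Ioo, hfstar.integral_eq_one]
    simp only [hG, this, hγ]
    ring
  obtain ⟨y, hy, hyG⟩ := I.exists_pathProd_eq hGmono hG0 hG1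
  set v : ℕ → ℝ → ℝ := fun n t => stepDensity I.a I.len n y t with hv
  have hvm : ∀ n, Measurable (v n) := fun n => I.measurable_stepDensity n y
  have hv_eq : ∀ n, ∀ t ∈ Ico (0 : ℝ) 1, v n t =
      q * ((∫ u in I.a (I.locate t n)..I.a (I.locate t n) + I.len (I.locate t n), fstar u) /
        I.len (I.locate t n)) + γ := by
    intro n t ht
    have hl := (I.len_pos (I.locate t n)).ne'
    have hbd := I.a_nonneg_and_a_add_len_le_one (I.locate t n)
    have hl0 := I.len_pos (I.locate t n)
    have h0 : (0 : ℝ) ∈ Icc (0 : ℝ) 1 := by simp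
    have := intervalIntegral.integral_interval_sub_left
      (hsub.intervalIntegrable h0 (y := I.a (I.locate t n) + I.len (I.locate t n))
        ⟨by linarith, hbd.2⟩)
      (hsub.intervalIntegrable h0 (y := I.a (I.locate t n)) ⟨hbd.1, by linarith⟩)
    rw [hv, ← this]
    simp only [I.stepDensity_eq n y ht, hyG, hG]
    field_simp
    ring
  have hvγ : ∀ n, ∀ t ∈ Ico (0 : ℝ) 1, γ ≤ v n t := by
    intro n t ht
    have hbd := I.a_nonneg_and_a_add_len_le_one (I.locate t n)
    have hl0 := I.len_pos (I.locate t n)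
    rw [hv_eq n t ht]
    have : 0 ≤ ∫ u in I.a (I.locate t n)..I.a (I.locate t n) + I.len (I.locate t n), fstar u := by
      rw [intervalIntegral.integral_of_le (by linarith), integral_Ioc_eq_integral_Ioo]
      exact setIntegral_nonneg measurableSet_Ioo fun u hu =>
        hfstar.nonneg u ⟨by linarith [hu.1], by linarith [hu.2]⟩
    have := mul_nonneg hq0.le (div_nonneg this hl0.le)
    linarith
  have hvlim : ∀ᵐ t ∂volume.restrict (Ico (0 : ℝ) 1),
      Tendsto (fun n => v n t) atTop (𝓝 (q * fstar t + γ)) := by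
    filter_upwards [hI.ae_tendsto_average hfstar.integrableOn, ae_restrict_mem measurableSet_Ico]
      with t h ht
    simp only [fun n => hv_eq n t ht]
    exact (h.const_mul q).add_const γ
  have hint : ∀ n, IntegrableOn (fun t => fstar t * Real.log (v n t)) (Ico 0 1) := by
    intro n
    obtain ⟨b, C, hb, -, hbC⟩ := I.exists_bounds_stepDensity n hy
    exact hsub.integrableOn_mul (Real.measurable_log.comp (hvm n))
      fun t ht => abs_log_le_of_mem_Icc hb (hbC t ht)
  by_contra! hcon
  have hcon' := fun n => hcon n y hy
  set E : ℝ := ∫ t in Ico (0 : ℝ) 1, fstar t * Real.log (fstar t) with hE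
  -- The integrals in Fatou's lemma: `u n` is nonnegative because `v n ≥ γ`.
  set u : ℕ → ℝ → ENNReal := fun n t => ENNReal.ofReal (fstar t * (Real.log (v n t) - Real.log γ))
  have hum : ∀ n, Measurable (u n) := fun n =>
    (hfstar.measurable.mul ((Real.measurable_log.comp (hvm n)).sub_const _)).ennreal_ofReal
  have hnn : ∀ n, ∀ t ∈ Ico (0 : ℝ) 1, 0 ≤ fstar t * (Real.log (v n t) - Real.log γ) :=
    fun n t ht => mul_nonneg (hfstar.nonneg t ht)
      (sub_nonneg.2 (Real.log_le_log hγ0 (hvγ n t ht)))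
  have hreal : ∀ n, ∫ t in Ico (0 : ℝ) 1, fstar t * (Real.log (v n t) - Real.log γ) =
      (∫ t in Ico (0 : ℝ) 1, fstar t * Real.log (v n t)) - Real.log γ := by
    intro n
    simp only [mul_sub]
    rw [integral_sub (hint n) (hfstar.integrableOn.mul_const _), integral_mul_const,
      hfstar.integral_eq_one, one_mul]
  have hint' : ∀ n, IntegrableOn (fun t => fstar t * (Real.log (v n t) - Real.log γ))
      (Ico 0 1) := by
    intro n
    simp only [mul_sub]
    exact (hint n).sub (hfstar.integrableOn.mul_const _)
  have hu_le : ∀ n, ∫⁻ t in Ico (0 : ℝ) 1, u n t ≤ ENNReal.ofReal (E - η - Real.log γ) := by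
    intro n
    rw [← ofReal_integral_eq_lintegral_ofReal (hint' n)
      ((ae_restrict_iff' measurableSet_Ico).2 (ae_of_all _ (hnn n))), hreal n]
    exact ENNReal.ofReal_le_ofReal (by linarith [hcon' n])
  have hrhs : 0 ≤ E - η - Real.log γ := by
    have : 0 ≤ ∫ t in Ico (0 : ℝ) 1, fstar t * (Real.log (v 0 t) - Real.log γ) :=
      setIntegral_nonneg measurableSet_Ico (hnn 0)
    rw [hreal 0] at this
    linarith [hcon' 0]
  set φ : ℝ → ℝ := fun t => fstar t * Real.log (fstar t) + fstar t * (-(η / 2) - Real.log γ)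
    with hφ
  have hφint : IntegrableOn φ (Ico 0 1) := hent.add (hfstar.integrableOn.mul_const _)
  have hφle : ∀ᵐ t ∂volume.restrict (Ico (0 : ℝ) 1),
      ENNReal.ofReal (max (φ t) 0) ≤ liminf (fun n => u n t) atTop := by
    filter_upwards [hvlim, ae_restrict_mem measurableSet_Ico] with t h ht
    have hf0 := hfstar.nonneg t ht
    have hpos : 0 < q * fstar t + γ := by positivity
    have hlim : Tendsto (fun n => u n t) atTop
        (𝓝 (ENNReal.ofReal (fstar t * (Real.log (q * fstar t + γ) - Real.log γ)))) :=
      ENNReal.tendsto_ofReal (((h.log hpos.ne').sub_const _).const_mul _)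
    rw [hlim.liminf_eq]
    refine ENNReal.ofReal_le_ofReal (max_le ?_ ?_)
    · rcases hf0.eq_or_lt with h0 | h0
      · simp [hφ, ← h0]
      · have h1 : Real.log (q * fstar t) ≤ Real.log (q * fstar t + γ) :=
          Real.log_le_log (by positivity) (by linarith)
        rw [Real.log_mul hq0.ne' h0.ne', hq, Real.log_exp] at h1
        have := mul_le_mul_of_nonneg_left h1 hf0
        simp only [hφ]
        rw [← hq] at this
        linarith
    · refine mul_nonneg hf0 (sub_nonneg.2 (Real.log_le_log hγ0 ?_))
      have := mul_nonneg hq0.le hf0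
      linarith
  have hfatou : ENNReal.ofReal (E - η / 2 - Real.log γ) ≤
      ENNReal.ofReal (E - η - Real.log γ) := by
    calc ENNReal.ofReal (E - η / 2 - Real.log γ)
        = ENNReal.ofReal (∫ t in Ico (0 : ℝ) 1, φ t) := by
          rw [hφ, integral_add hent (hfstar.integrableOn.mul_const _), integral_mul_const,
            hfstar.integral_eq_one]
          congr 1
          ring
      _ ≤ ENNReal.ofReal (∫ t in Ico (0 : ℝ) 1, max (φ t) 0) :=
          ENNReal.ofReal_le_ofReal
            (integral_mono hφint hφint.pos_part fun t => le_max_left _ _)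
      _ = ∫⁻ t in Ico (0 : ℝ) 1, ENNReal.ofReal (max (φ t) 0) :=
          ofReal_integral_eq_lintegral_ofReal hφint.pos_part (ae_of_all _ fun t => le_max_right _ _)
      _ ≤ ∫⁻ t in Ico (0 : ℝ) 1, liminf (fun n => u n t) atTop := lintegral_mono_ae hφle
      _ ≤ liminf (fun n => ∫⁻ t in Ico (0 : ℝ) 1, u n t) atTop := lintegral_liminf_le hum
      _ ≤ liminf (fun _ : ℕ => ENNReal.ofReal (E - η - Real.log γ)) atTop :=
          liminf_le_liminf (Eventually.of_forall hu_le)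
      _ = ENNReal.ofReal (E - η - Real.log γ) := liminf_const _
  have := (ENNReal.ofReal_le_ofReal_iff hrhs).1 hfatou
  linarith

end NBP

/-! ### Kullback–Leibler support of the two priors -/

theorem isOpen_forall_mul_pathProd_lt (c : ℝ) (y : BetaSeq) (n : ℕ) :
    IsOpen {y' : BetaSeq | ∀ x : Fin n → Bool,
      c * pathProd y (List.ofFn x) < pathProd y' (List.ofFn x)} := by
  simp only [ofPred_forall]
  exact isOpen_iInter_of_finite fun x => isOpen_lt continuous_const (continuous_pathProd _)

theorem exp_neg_mem_Ioo {η : ℝ} (hη : 0 < η) : Real.exp (-η) ∈ Ioo (0 : ℝ) 1 :=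
  ⟨Real.exp_pos _, Real.exp_lt_one_iff.2 (by linarith)⟩

theorem IsPDF.integral_mul_log_const_mul {fstar : ℝ → ℝ} (hfstar : IsPDF fstar) {g : ℝ → ℝ}
    (hg : Measurable g) {b C : ℝ} (hb : 0 < b) (hgb : ∀ t ∈ Ico (0 : ℝ) 1, g t ∈ Icc b C) (η : ℝ) :
    ∫ t in Ico (0 : ℝ) 1, fstar t * Real.log (Real.exp (-η) * g t) =
      (∫ t in Ico (0 : ℝ) 1, fstar t * Real.log (g t)) - η := by
  have h1 : ∀ t ∈ Ico (0 : ℝ) 1, fstar t * Real.log (Real.exp (-η) * g t) =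
      fstar t * Real.log (g t) - fstar t * η := fun t ht => by
    rw [Real.log_mul (Real.exp_pos _).ne' (hb.trans_le (hgb t ht).1).ne', Real.log_exp]
    ring
  have h2 : IntegrableOn (fun t => fstar t * Real.log (g t)) (Ico 0 1) :=
    hfstar.isSubPDF.integrableOn_mul (Real.measurable_log.comp hg)
      fun t ht => abs_log_le_of_mem_Icc hb (hgb t ht)
  rw [setIntegral_congr_fun measurableSet_Ico h1, integral_sub h2 (hfstar.integrableOn.mul_const _),
    integral_mul_const, hfstar.integral_eq_one, one_mul]

instance (p : PMF ℕ) (α : Word → ℝ) : IsProbabilityMeasure (prior₁ p α) := by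
  unfold prior₁
  infer_instance

instance (p : PMF ℕ) (α β : Word → ℝ) : IsProbabilityMeasure (prior₂ p α β) := by
  unfold prior₂
  infer_instance

theorem measurable_uncurry_density₁ (I : NBP) : Measurable (Function.uncurry (density₁ I)) := by
  have h : Measurable fun q : ℕ × BetaSeq × ℝ => stepDensity I.a I.len q.1 q.2.1 q.2.2 :=
    measurable_from_prod_countable_right fun n =>
      measurable_stepDensity (X := BetaSeq × ℝ) (a := fun _ => I.a) (len := fun _ => I.len)
        (y := fun q => q.1) (t := fun q => q.2)
        (fun _ => measurable_const) (fun _ => measurable_const) measurable_fst measurable_snd n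
  have h' : Measurable fun q : (ℕ × BetaSeq) × ℝ => (q.1.1, q.1.2, q.2) := by fun_prop
  exact h.comp h'

theorem measurable_uncurry_density₂ : Measurable (Function.uncurry density₂) := by
  have h : Measurable fun q : ℕ × (BetaSeq × BetaSeq) × ℝ =>
      stepDensity (randLeft q.2.1.2) (randLen q.2.1.2) q.1 q.2.1.1 q.2.2 :=
    measurable_from_prod_countable_right fun n =>
      measurable_stepDensity (X := (BetaSeq × BetaSeq) × ℝ) (a := fun q => randLeft q.1.2)
        (len := fun q => randLen q.1.2) (y := fun q => q.1.1) (t := fun q => q.2)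
        (fun w => (continuous_randLeft w).measurable.comp (measurable_snd.comp measurable_fst))
        (fun w => (continuous_randLen w).measurable.comp (measurable_snd.comp measurable_fst))
        (measurable_fst.comp measurable_fst) measurable_snd n
  have h' : Measurable fun q : (ℕ × BetaSeq × BetaSeq) × ℝ => (q.1.1, q.1.2, q.2) := by fun_prop
  have e : Function.uncurry density₂ = (fun q : ℕ × (BetaSeq × BetaSeq) × ℝ =>
      stepDensity (randLeft q.2.1.2) (randLen q.2.1.2) q.1 q.2.1.1 q.2.2) ∘
        fun q : (ℕ × BetaSeq × BetaSeq) × ℝ => (q.1.1, q.1.2, q.2) := by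
    ext ⟨⟨n, y, r⟩, t⟩
    simp only [Function.uncurry_apply_pair, density₂, Function.comp_apply]
  rw [e]
  exact h.comp h'

theorem NBP.isSubPDF_stepDensity (I : NBP) (n : ℕ) {y : BetaSeq}
    (hy : ∀ s, y s ∈ Ioo (0 : ℝ) 1) : IsSubPDF (stepDensity I.a I.len n y) :=
  ⟨I.measurable_stepDensity n y, fun _ ht => (I.stepDensity_pos n hy ht).le,
    I.lintegral_stepDensity_le n hy⟩

section Priors

variable {p : PMF ℕ} {α β : Word → ℝ} {fstar : ℝ → ℝ}

theorem ae_prior₁_mem_Ioo (hα : ∀ s : Word, s ≠ [] → 0 < α s) :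
    ∀ᵐ θ ∂prior₁ p α, ∀ s, θ.2 s ∈ Ioo (0 : ℝ) 1 :=
  Measure.quasiMeasurePreserving_snd.ae (ae_betaSeqLaw_mem_Ioo hα)

theorem ae_prior₂_mem_Ioo (hα : ∀ s : Word, s ≠ [] → 0 < α s)
    (hβ : ∀ s : Word, s ≠ [] → 0 < β s) :
    ∀ᵐ θ ∂prior₂ p α β,
      (∀ s, θ.2.1 s ∈ Ioo (0 : ℝ) 1) ∧ ∀ s, θ.2.2 s ∈ Ioo (0 : ℝ) 1 := by
  refine Measure.quasiMeasurePreserving_snd.ae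
    (p := fun q : BetaSeq × BetaSeq => (∀ s, q.1 s ∈ Ioo (0 : ℝ) 1) ∧ ∀ s, q.2 s ∈ Ioo (0 : ℝ) 1) ?_
  exact (Measure.quasiMeasurePreserving_fst.ae (ae_betaSeqLaw_mem_Ioo hα)).and
    (Measure.quasiMeasurePreserving_snd.ae (ae_betaSeqLaw_mem_Ioo hβ))

theorem klSupported_prior₁ (hp : ∀ n, 0 < p n) (hα : ∀ s : Word, s ≠ [] → 0 < α s) {I : NBP}
    (hI : I.Shrinking) (hfstar : IsPDF fstar)
    (hent : IntegrableOn (fun t => fstar t * Real.log (fstar t)) (Ico 0 1)) :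
    KLSupported (prior₁ p α) (density₁ I) fstar := by
  intro η hη
  obtain ⟨n, y, hy, hlt⟩ :=
    hI.exists_lt_integral_mul_log_stepDensity hfstar hent (half_pos hη)
  obtain ⟨b, C, hb, -, hbC⟩ := I.exists_bounds_stepDensity n hy
  set c : ℝ := Real.exp (-(η / 2)) with hc
  obtain ⟨hc0, hc1⟩ : c ∈ Ioo (0 : ℝ) 1 := exp_neg_mem_Ioo (half_pos hη)
  set V : Set BetaSeq := {y' | ∀ x : Fin n → Bool,
    c * pathProd y (List.ofFn x) < pathProd y' (List.ofFn x)} with hV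
  have hVo : IsOpen V := isOpen_forall_mul_pathProd_lt c y n
  have hyV : y ∈ V := fun x => mul_lt_of_lt_one_left (pathProd_pos hy _) hc1
  have hDm := I.measurable_stepDensity n y
  refine ⟨{n} ×ˢ V, fun t => c * stepDensity I.a I.len n y t, c * b, c * C,
    (measurableSet_singleton n).prod hVo.measurableSet, ?_, hDm.const_mul c, by positivity,
    fun t ht => ⟨mul_le_mul_of_nonneg_left (hbC t ht).1 hc0.le,
      mul_le_mul_of_nonneg_left (hbC t ht).2 hc0.le⟩, ae_of_all _ ?_, ?_⟩
  · rw [prior₁, Measure.prod_prod, PMF.toMeasure_apply_singleton _ _ (measurableSet_singleton n)]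
    exact ENNReal.mul_pos (hp n).ne' (betaSeqLaw_pos_of_isOpen hα hVo hyV hy).ne'
  · rintro ⟨n', y'⟩ ⟨hn, hy'⟩ t ht
    obtain rfl : n' = n := hn
    obtain ⟨x, hx⟩ := I.exists_ofFn_eq_locate t n'
    have h := hy' x
    rw [hx] at h
    simp only [density₁]
    rw [I.stepDensity_eq n' y ht, I.stepDensity_eq n' y' ht, ← mul_div_assoc]
    exact div_le_div_of_nonneg_right h.le (I.len_pos _).le
  · rw [hc, hfstar.integral_mul_log_const_mul hDm hb hbC]
    linarith

/-- The partition is itself random under this prior. It is close to the dyadic one with positive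
probability, and away from the dyadic end points a small perturbation of the partition does not
change the word of an interval that contains a given point. -/
theorem klSupported_prior₂ (hp : ∀ n, 0 < p n) (hα : ∀ s : Word, s ≠ [] → 0 < α s)
    (hβ : ∀ s : Word, s ≠ [] → 0 < β s) (hfstar : IsPDF fstar)
    (hent : IntegrableOn (fun t => fstar t * Real.log (fstar t)) (Ico 0 1)) :
    KLSupported (prior₂ p α β) density₂ fstar := by
  intro η hη
  have hη3 : 0 < η / 3 := by positivity
  have hη6 : 0 < η / 6 := by positivity
  obtain ⟨n, y, hy, hlt⟩ :=
    shrinking_dyadic.exists_lt_integral_mul_log_stepDensity hfstar hent hη3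
  set I : NBP := dyadic with hI
  obtain ⟨b, C, hb, hbx, hbC⟩ := I.exists_bounds_stepDensity n hy
  set D : ℝ → ℝ := stepDensity I.a I.len n y with hD
  have hDm : Measurable D := I.measurable_stepDensity n y
  set d : ℝ := Real.exp (-(η / 6)) with hd
  obtain ⟨hd0, hd1⟩ : d ∈ Ioo (0 : ℝ) 1 := exp_neg_mem_Ioo hη6
  set c : ℝ := Real.exp (-(η / 3)) with hc
  have hc0 : 0 < c := Real.exp_pos _
  have hcd : c = d * d := by
    rw [hc, hd, ← Real.exp_add]
    ring_nf
  -- `B τ` is the `τ`-neighbourhood of the end points of the dyadic partition.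
  set B : ℝ → Set ℝ := fun τ => ⋃ x : Fin n → Bool,
    Metric.closedBall (I.a (List.ofFn x)) τ ∪
      Metric.closedBall (I.a (List.ofFn x) + I.len (List.ofFn x)) τ with hB
  have hBm : ∀ τ, MeasurableSet (B τ) := fun τ => MeasurableSet.iUnion fun x =>
    Metric.isClosed_closedBall.measurableSet.union Metric.isClosed_closedBall.measurableSet
  classical
  set h : ℝ → ℝ → ℝ := fun τ t => c * (B τ).piecewise (fun _ => b) D t with hh
  have hhm : ∀ τ, Measurable (h τ) := fun τ =>
    (Measurable.piecewise (hBm τ) measurable_const hDm).const_mul c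
  have hbC0 : b ≤ C := (hbC 0 (by simp)).1.trans (hbC 0 (by simp)).2
  have hhb : ∀ τ, ∀ t ∈ Ico (0 : ℝ) 1, h τ t ∈ Icc (c * b) (c * C) := by
    intro τ t ht
    by_cases hB : t ∈ B τ
    · simp only [hh, piecewise_eq_of_mem _ _ _ hB]
      exact ⟨le_rfl, mul_le_mul_of_nonneg_left hbC0 hc0.le⟩
    · simp only [hh, piecewise_eq_of_notMem _ _ _ hB]
      exact ⟨mul_le_mul_of_nonneg_left (hbC t ht).1 hc0.le,
        mul_le_mul_of_nonneg_left (hbC t ht).2 hc0.le⟩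
  have hcb : 0 < c * b := by positivity
  -- As `τ → 0` the lower bound `h τ` converges to `c * D` off the finitely many end points.
  have hτ0 : Tendsto (fun k : ℕ => 1 / ((k : ℝ) + 1)) atTop (𝓝 0) :=
    tendsto_one_div_add_atTop_nhds_zero_nat
  have hlim : Tendsto
      (fun k : ℕ => ∫ t in Ico (0 : ℝ) 1, fstar t * Real.log (h (1 / ((k : ℝ) + 1)) t)) atTop
      (𝓝 (∫ t in Ico (0 : ℝ) 1, fstar t * Real.log (c * D t))) := by
    refine tendsto_integral_of_dominated_convergence
      (fun t => ‖fstar t‖ * (|Real.log (c * b)| + |Real.log (c * C)|))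
      (fun k => (hfstar.measurable.mul (Real.measurable_log.comp (hhm _))).aestronglyMeasurable)
      (hfstar.integrableOn.norm.mul_const _) (fun k => ?_) ?_
    · filter_upwards [ae_restrict_mem measurableSet_Ico] with t ht
      rw [norm_mul]
      exact mul_le_mul_of_nonneg_left (abs_log_le_of_mem_Icc hcb (hhb _ t ht)) (norm_nonneg _)
    · have hnull : ∀ᵐ t : ℝ, ∀ x : Fin n → Bool,
          t ≠ I.a (List.ofFn x) ∧ t ≠ I.a (List.ofFn x) + I.len (List.ofFn x) :=
        ae_all_iff.2 fun x => (Measure.ae_ne volume _).and (Measure.ae_ne volume _)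
      filter_upwards [ae_restrict_of_ae hnull] with t ht
      have hev : ∀ᶠ k : ℕ in atTop, t ∉ B (1 / ((k : ℝ) + 1)) := by
        have : ∀ᶠ k : ℕ in atTop, ∀ x : Fin n → Bool,
            1 / ((k : ℝ) + 1) < dist t (I.a (List.ofFn x)) ∧
            1 / ((k : ℝ) + 1) < dist t (I.a (List.ofFn x) + I.len (List.ofFn x)) :=
          eventually_all.2 fun x => (hτ0.eventually (gt_mem_nhds (dist_pos.2 (ht x).1))).and
            (hτ0.eventually (gt_mem_nhds (dist_pos.2 (ht x).2)))
        filter_upwards [this] with k hk hmem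
        obtain ⟨x, hx⟩ := mem_iUnion.1 hmem
        rcases hx with hx | hx
        · exact absurd (Metric.mem_closedBall.1 hx) (not_le.2 (hk x).1)
        · exact absurd (Metric.mem_closedBall.1 hx) (not_le.2 (hk x).2)
      refine tendsto_const_nhds.congr' ?_
      filter_upwards [hev] with k hk
      simp only [hh, piecewise_eq_of_notMem _ _ _ hk]
  have hlt' : (∫ t in Ico (0 : ℝ) 1, fstar t * Real.log (fstar t)) - η <
      ∫ t in Ico (0 : ℝ) 1, fstar t * Real.log (c * D t) := by
    rw [hc, hfstar.integral_mul_log_const_mul hDm hb hbC]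
    linarith
  obtain ⟨k, hk⟩ := (hlim.eventually (lt_mem_nhds hlt')).exists
  set τ : ℝ := 1 / ((k : ℝ) + 1) with hτ
  have hτpos : 0 < τ := by positivity
  set V : Set BetaSeq := {y' | ∀ x : Fin n → Bool,
    d * pathProd y (List.ofFn x) < pathProd y' (List.ofFn x)} with hV
  have hVo : IsOpen V := isOpen_forall_mul_pathProd_lt d y n
  have hyV : y ∈ V := fun x => mul_lt_of_lt_one_left (pathProd_pos hy _) hd1
  set r₀ : BetaSeq := fun _ => 1 / 2 with hr₀
  have hr₀01 : ∀ s, r₀ s ∈ Ioo (0 : ℝ) 1 := fun s => by norm_num [hr₀]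
  have hIa : I.a = randLeft r₀ := rfl
  have hIlen : I.len = randLen r₀ := rfl
  set R : Set BetaSeq := {r | ∀ x : Fin n → Bool,
    d * randLen r (List.ofFn x) < I.len (List.ofFn x) ∧
    I.a (List.ofFn x) - τ < randLeft r (List.ofFn x) ∧
    randLeft r (List.ofFn x) + randLen r (List.ofFn x) <
      I.a (List.ofFn x) + I.len (List.ofFn x) + τ} with hR
  have hRo : IsOpen R := by
    simp only [hR, ofPred_forall, ofPred_and]
    refine isOpen_iInter_of_finite fun x => ?_
    exact (isOpen_lt ((continuous_randLen _).const_mul d) continuous_const).inter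
      ((isOpen_lt continuous_const (continuous_randLeft _)).inter
        (isOpen_lt ((continuous_randLeft _).add (continuous_randLen _)) continuous_const))
  have hrR : r₀ ∈ R := fun x => by
    rw [← hIa, ← hIlen]
    exact ⟨mul_lt_of_lt_one_left (I.len_pos _) hd1, by linarith, by linarith⟩
  refine ⟨{n} ×ˢ V ×ˢ R, h τ, c * b, c * C,
    (measurableSet_singleton n).prod (hVo.measurableSet.prod hRo.measurableSet), ?_, hhm τ, hcb,
    hhb τ, ?_, hk⟩
  · rw [prior₂, Measure.prod_prod, Measure.prod_prod,
      PMF.toMeasure_apply_singleton _ _ (measurableSet_singleton n)]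
    exact ENNReal.mul_pos (hp n).ne'
      (ENNReal.mul_pos (betaSeqLaw_pos_of_isOpen hα hVo hyV hy).ne'
        (betaSeqLaw_pos_of_isOpen hβ hRo hrR hr₀01).ne').ne'
  · filter_upwards [ae_prior₂_mem_Ioo hα hβ]
    rintro ⟨n', y', r⟩ ⟨hy', hr⟩ ⟨hn, hyV', hrR'⟩ t ht
    obtain rfl : n' = n := hn
    simp only at hyV' hrR' hy' hr
    set J : NBP := NBP.ofRatio r hr with hJ
    obtain ⟨x, hx⟩ := J.exists_ofFn_eq_locate t n'
    have hdens : density₂ (n', y', r) t = pathProd y' (List.ofFn x) / J.len (List.ofFn x) := by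
      rw [hx]
      exact J.stepDensity_eq n' y' ht
    have hJlen := J.len_pos (List.ofFn x)
    have hIlen0 := I.len_pos (List.ofFn x)
    obtain ⟨r1, r2, r3⟩ := hrR' x
    change d * J.len (List.ofFn x) < _ at r1
    have hval : c * (pathProd y (List.ofFn x) / I.len (List.ofFn x)) ≤ density₂ (n', y', r) t := by
      rw [hdens, hcd, ← mul_div_assoc, div_le_div_iff₀ hIlen0 hJlen]
      have h1 := mul_le_mul_of_nonneg_left r1.le
        (mul_nonneg hd0.le (pathProd_pos hy (List.ofFn x)).le)
      have h2 := mul_le_mul_of_nonneg_right (hyV' x).le hIlen0.le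
      linarith
    refine le_trans ?_ hval
    refine mul_le_mul_of_nonneg_left ?_ hc0.le
    by_cases hBt : t ∈ B τ
    · rw [piecewise_eq_of_mem _ _ _ hBt]
      exact (hbx x).1
    · rw [piecewise_eq_of_notMem _ _ _ hBt]
      have hmem := J.mem_locate ht n'
      rw [← hx] at hmem
      have hJa : J.a (List.ofFn x) = randLeft r (List.ofFn x) := rfl
      have hJl : J.len (List.ofFn x) = randLen r (List.ofFn x) := rfl
      rw [hJa, hJl] at hmem
      have hfar : τ < |t - I.a (List.ofFn x)| ∧
          τ < |t - (I.a (List.ofFn x) + I.len (List.ofFn x))| := by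
        constructor <;> refine not_le.1 fun hle => hBt (mem_iUnion.2 ⟨x, ?_⟩)
        · exact Or.inl (Metric.mem_closedBall.2 hle)
        · exact Or.inr (Metric.mem_closedBall.2 hle)
      have hin : t ∈ Ico (I.a (List.ofFn x)) (I.a (List.ofFn x) + I.len (List.ofFn x)) := by
        constructor
        · rcases lt_abs.1 hfar.1 with h' | h' <;> linarith [hmem.1]
        · rcases lt_abs.1 hfar.2 with h' | h' <;> linarith [hmem.2]
      have hloc := I.locate_eq hin
      rw [List.length_ofFn] at hloc
      rw [hD, I.stepDensity_eq n' y ht, hloc]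

end Priors

end PolyaTree

/-- Both priors charge Kullback–Leibler neighbourhoods of `fstar`, so that Schwartz's theorem
applies to them. -/
theorem theorem8 {Ω : Type*} [MeasurableSpace Ω] (P : Measure Ω) [IsProbabilityMeasure P]
    (fstar : ℝ → ℝ) (hfstar : IsPDF fstar)
    (Z : ℕ → Ω → ℝ) (hZ_meas : ∀ i, Measurable (Z i)) (hZ_law : ∀ i, P.map (Z i) = pdfLaw fstar)
    (hZ_indep : iIndepFun Z P)
    (hent : IntegrableOn (fun t => fstar t * Real.log (fstar t)) (Ico 0 1))
    (p : PMF ℕ) (hp : ∀ n, 0 < p n)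
    (α : Word → ℝ) (hα : ∀ s : Word, s ≠ [] → 0 < α s)
    (ε : ℝ) (hε : 0 < ε) :
    (∀ I : NBP, I.Shrinking →
      KSConsistent P Z fstar (prior₁ p α) (density₁ I) ε) ∧
    (∀ β : Word → ℝ, (∀ s : Word, s ≠ [] → 0 < β s) →
      KSConsistent P Z fstar (prior₂ p α β) density₂ ε) := by
  refine ⟨fun I hI => ?_, fun β hβ => ?_⟩
  · refine (klSupported_prior₁ hp hα hI hfstar hent).ksConsistent (measurable_uncurry_density₁ I)
      ?_ hfstar hZ_meas hZ_law hZ_indep hent hε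
    filter_upwards [ae_prior₁_mem_Ioo hα] with θ hθ
    exact I.isSubPDF_stepDensity θ.1 hθ
  · refine (klSupported_prior₂ hp hα hβ hfstar hent).ksConsistent measurable_uncurry_density₂
      ?_ hfstar hZ_meas hZ_law hZ_indep hent hε
    filter_upwards [ae_prior₂_mem_Ioo hα hβ] with θ hθ
    exact (NBP.ofRatio θ.2.2 hθ.2).isSubPDF_stepDensity θ.1 hθ.1
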